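/- Let $\Omega\subset\mathbb R^n$ be a bounded domain with smooth boundary $\Gamma$ and outer unit normal $\vec n$, let $\nu>0$ and $G\in W^{1,\infty}(\Omega)\cap W^{2,\max(2,n)}(\Omega)$. All spaces are real. In $\mathcal Y=L^2(\Omega)$ consider the unbounded operator $$\mathcal A\rho=\nu\Delta\rho+\nabla\cdot(\rho\nabla G),\qquad \mathcal D(\mathcal A)=\{\rho\in H^2(\Omega):(\nu\nabla\rho+\rho\nabla G)\cdot\vec n=0\text{ on }\Gamma\},$$ and let $\mathcal A^*$ be its adjoint in $L^2(\Omega)$. Let $\Phi=\log\nu+G/\nu$, let $\rho_\infty=e^{-\Phi}/\int_\Omega e^{-\Phi}\,dx$, and let $\mathbb 1$ be the constant function with value $1$. Let $\mathcal Py=y-\big(\int_\Omega y\,dx\big)\rho_\infty$ on $L^2(\Omega)$, with adjoint $\mathcal P^*y=y-\big(\int_\Omega\rho_\infty y\,dx\big)\mathbb 1$. Let $\mathcal Y_{\mathcal P}=\operatorname{im}\mathcal P=\{v\in L^2(\Omega):\int_\Omega v\,dx=0\}$, and let $\Theta$ be the orthogonal projection of $L^2(\Omega)$ onto $\mathcal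 Y_{\mathcal P}$. Let $\widehat{\mathcal A}$ be the restriction of $\mathcal A$ to $\mathcal D(\widehat{\mathcal A})=\mathcal D(\mathcal A)\cap\mathcal Y_{\mathcal P}$, considered as an unbounded operator in $\mathcal Y_{\mathcal P}$ (it takes values in $\mathcal Y_{\mathcal P}$), and let $$\mathcal A^\sharp\phi=\Theta\mathcal A^*\phi,\qquad \mathcal D(\mathcal A^\sharp)=\mathcal D(\mathcal A^*)\cap\mathcal Y_{\mathcal P},$$ as an unbounded operator in $\mathcal Y_{\mathcal P}$. An eigenpair of an operator $T$ is a pair $(\lambda,x)$ with $x\in\mathcal D(T)$, $x\neq0$ and $Tx=\lambda x$. Then: 1. $\mathcal A$ and $\widehat{\mathcal A}$ are densely defined, and $\mathcal A^\sharp$ is the adjoint of $\widehat{\mathcal A}$ in $\mathcal Y_{\mathcal P}$: $\widehat{\mathcal A}^{\,*}=\mathcal A^\sharp$, with equal domains. 2. If $(\lambda,\phi)\in\mathbb R\times\mathcal D(\mathcal A^\sharp)$ is an eigenpair of $\mathcal A^\sharp$, then $(\lambda,\mathcal P^*\phi)$ is an eigenpair of $\mathcal A^*$. 3. If $(\lambda,\varphi)\in\mathbb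 R\times\mathcal D(\mathcal A^*)$ is an eigenpair of $\mathcal A^*$, then $\Theta\varphi\in\mathcal D(\mathcal A^\sharp)$ and $\mathcal A^\sharp\Theta\varphi=\lambda\Theta\varphi$. If moreover $\lambda\neq0$ or $\varphi$ is not a constant function, then $\Theta\varphi\neq0$, so that $(\lambda,\Theta\varphi)$ is an eigenpair of $\mathcal A^\sharp$. -/

import Mathlib

open MeasureTheory Set
open scoped ENNReal ContDiff InnerProductSpace

noncomputable section

/-- Euclidean space `ℝⁿ`. -/
abbrev Eucl (n : ℕ) : Type := EuclideanSpace ℝ (Fin n)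

/-! ### Weak derivatives and Sobolev spaces on an open set `Ω ⊆ ℝⁿ` -/

/-- The classical partial derivative `∂φ/∂xᵢ`. -/
def partialD {n : ℕ} (i : Fin n) (φ : Eucl n → ℝ)
    (x : Eucl n) : ℝ :=
  fderiv ℝ φ x (EuclideanSpace.single i 1)

/-- Test functions: `φ ∈ C_c^∞(Ω)`. -/
def IsTestFunction {n : ℕ} (Ω : Set (Eucl n))
    (φ : Eucl n → ℝ) : Prop :=
  ContDiff ℝ ∞ φ ∧ HasCompactSupport φ ∧ tsupport φ ⊆ Ω

/-- `w` is the weak partial derivative `∂ᵢ u` in `Ω`. -/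
def HasWeakPartial {n : ℕ} (Ω : Set (Eucl n)) (i : Fin n)
    (u w : Eucl n → ℝ) : Prop :=
  LocallyIntegrableOn u Ω ∧ LocallyIntegrableOn w Ω ∧
    ∀ φ, IsTestFunction Ω φ → ∫ x in Ω, u x * partialD i φ x = -∫ x in Ω, w x * φ x

/-- `w` is the weak (distributional) divergence of the vector field `F` in `Ω`. -/
def HasWeakDiv {n : ℕ} (Ω : Set (Eucl n))
    (F : Fin n → Eucl n → ℝ) (w : Eucl n → ℝ) : Prop :=
  (∀ i, LocallyIntegrableOn (F i) Ω) ∧ LocallyIntegrableOn w Ω ∧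
    ∀ φ, IsTestFunction Ω φ →
      ∫ x in Ω, ∑ i, F i x * partialD i φ x = -∫ x in Ω, w x * φ x

open Classical in
/-- The weak partial derivative `∂ᵢ u` in `Ω` (a representative of it, if it exists; it is unique
up to null sets). -/
def weakPartial {n : ℕ} (Ω : Set (Eucl n)) (i : Fin n)
    (u : Eucl n → ℝ) : Eucl n → ℝ :=
  if h : ∃ w, HasWeakPartial Ω i u w then h.choose else 0

open Classical in
/-- The weak divergence `∇ · F` in `Ω` (a representative of it, if it exists; it is unique up to
null sets). -/
def weakDiv {n : ℕ} (Ω : Set (Eucl n))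
    (F : Fin n → Eucl n → ℝ) : Eucl n → ℝ :=
  if h : ∃ w, HasWeakDiv Ω F w then h.choose else 0

/-- The weak Laplacian `Δu = ∑ᵢ ∂ᵢ∂ᵢ u`. -/
def weakLaplacian {n : ℕ} (Ω : Set (Eucl n))
    (u : Eucl n → ℝ) : Eucl n → ℝ :=
  fun x => ∑ i, weakPartial Ω i (weakPartial Ω i u) x

/-- `MemSobolev Ω k p u` says `u ∈ W^{k,p}(Ω)`: `u` and all its weak partial derivatives up to
order `k` exist and lie in `L^p(Ω)`. -/
def MemSobolev {n : ℕ} (Ω : Set (Eucl n)) :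
    ℕ → ℝ≥0∞ → (Eucl n → ℝ) → Prop
  | 0, p, u => MemLp u p (volume.restrict Ω)
  | k + 1, p, u => MemLp u p (volume.restrict Ω) ∧
      ∀ i, ∃ w, MemSobolev Ω k p w ∧ HasWeakPartial Ω i u w

/-- The normal trace of the vector field `F` on `∂Ω` vanishes, `F · n = 0` on `∂Ω`, for
`F ∈ L²_div(Ω)`, i.e. `F ∈ L²(Ω)ⁿ` with `∇ · F ∈ L²(Ω)`. The normal trace is the functional
`v ↦ ∫_Ω F · ∇v + ∫_Ω (∇ · F) v`, and it is tested with the functions `v ∈ C^∞(closure Ω)`. -/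
def HasZeroNormalTrace {n : ℕ} (Ω : Set (Eucl n))
    (F : Fin n → Eucl n → ℝ) : Prop :=
  (∀ i, MemLp (F i) 2 (volume.restrict Ω)) ∧
    ∃ w, MemLp w 2 (volume.restrict Ω) ∧ HasWeakDiv Ω F w ∧
      ∀ v : Eucl n → ℝ, ContDiff ℝ ∞ v →
        (∫ x in Ω, ∑ i, F i x * partialD i v x) + ∫ x in Ω, w x * v x = 0

/-- The boundary of `Ω` is smooth: near each boundary point, `Ω` is the sublevel set `{g < 0}` of
a smooth function `g` with nonvanishing differential at that point. -/
def HasSmoothBoundary {n : ℕ} (Ω : Set (Eucl n)) : Prop :=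
  ∀ x ∈ frontier Ω, ∃ (U : Set (Eucl n)) (g : Eucl n → ℝ),
    IsOpen U ∧ x ∈ U ∧ ContDiff ℝ ∞ g ∧ g x = 0 ∧ fderiv ℝ g x ≠ 0 ∧
      Ω ∩ U = {y ∈ U | g y < 0}

/-! ### Basic facts on weak derivatives -/

theorem continuous_partialD {n : ℕ} {φ : Eucl n → ℝ} (h : ContDiff ℝ ∞ φ) (i : Fin n) :
    Continuous (partialD i φ) :=
  (h.continuous_fderiv (by simp)).clm_apply continuous_const

theorem tsupport_partialD_subset {n : ℕ} (φ : Eucl n → ℝ) (i : Fin n) :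
    tsupport (partialD i φ) ⊆ tsupport φ := by
  refine closure_minimal ?_ (isClosed_tsupport φ)
  intro x hx
  by_contra hx'
  apply hx
  have : fderiv ℝ φ x = 0 := by
    by_contra h0
    exact hx' (support_fderiv_subset ℝ h0)
  simp [partialD, this]

theorem integrable_mul_of_tsupport_subset {n : ℕ} {Ω : Set (Eucl n)} {u ψ : Eucl n → ℝ}
    (hu : LocallyIntegrableOn u Ω) (hψ : Continuous ψ) (hc : HasCompactSupport ψ)
    (hs : tsupport ψ ⊆ Ω) : Integrable (fun x => u x * ψ x) (volume.restrict Ω) := by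
  have hc' : IsCompact (tsupport ψ) := hc
  have h1 : IntegrableOn u (tsupport ψ) := hu.integrableOn_compact_subset hs hc'
  have h2 : IntegrableOn (fun x => u x * ψ x) (tsupport ψ) := by
    obtain ⟨C, hC⟩ := hc'.exists_bound_of_continuousOn hψ.continuousOn
    refine Integrable.mul_bdd (c := C) h1 hψ.aestronglyMeasurable ?_
    exact (ae_restrict_iff' hc'.measurableSet).2 (Filter.Eventually.of_forall hC)
  refine Integrable.restrict (s := Ω) ?_
  refine (integrableOn_iff_integrable_of_support_subset ?_).1 h2
  intro x hx
  exact subset_tsupport ψ (right_ne_zero_of_mul hx)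

theorem HasWeakDiv.integrable_left {n : ℕ} {Ω : Set (Eucl n)} {F : Fin n → Eucl n → ℝ}
    {w φ : Eucl n → ℝ} (h : HasWeakDiv Ω F w) (hφ : IsTestFunction Ω φ) :
    Integrable (fun x => ∑ i, F i x * partialD i φ x) (volume.restrict Ω) :=
  integrable_finsetSum _ fun i _ => integrable_mul_of_tsupport_subset (h.1 i)
    (continuous_partialD hφ.1 i)
    (hφ.2.1.of_isClosed_subset (isClosed_tsupport _) (tsupport_partialD_subset φ i))
    ((tsupport_partialD_subset φ i).trans hφ.2.2)

theorem HasWeakDiv.integrable_right {n : ℕ} {Ω : Set (Eucl n)} {F : Fin n → Eucl n → ℝ}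
    {w φ : Eucl n → ℝ} (h : HasWeakDiv Ω F w) (hφ : IsTestFunction Ω φ) :
    Integrable (fun x => w x * φ x) (volume.restrict Ω) :=
  integrable_mul_of_tsupport_subset h.2.1 hφ.1.continuous hφ.2.1 hφ.2.2

theorem HasWeakDiv.add {n : ℕ} {Ω : Set (Eucl n)} {F F' : Fin n → Eucl n → ℝ}
    {w w' : Eucl n → ℝ} (h : HasWeakDiv Ω F w) (h' : HasWeakDiv Ω F' w') :
    HasWeakDiv Ω (fun i x => F i x + F' i x) (fun x => w x + w' x) := by
  refine ⟨fun i => (h.1 i).add (h'.1 i), h.2.1.add h'.2.1, fun φ hφ => ?_⟩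
  simp only [add_mul, Finset.sum_add_distrib]
  rw [integral_add (h.integrable_left hφ) (h'.integrable_left hφ),
    integral_add (h.integrable_right hφ) (h'.integrable_right hφ), h.2.2 φ hφ, h'.2.2 φ hφ]
  ring

theorem HasWeakDiv.const_mul {n : ℕ} {Ω : Set (Eucl n)} {F : Fin n → Eucl n → ℝ}
    {w : Eucl n → ℝ} (h : HasWeakDiv Ω F w) (c : ℝ) :
    HasWeakDiv Ω (fun i x => c * F i x) (fun x => c * w x) := by
  refine ⟨fun i => (h.1 i).smul c, h.2.1.smul c, fun φ hφ => ?_⟩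
  simp only [mul_assoc, ← Finset.mul_sum]
  rw [integral_const_mul, integral_const_mul, h.2.2 φ hφ]
  ring

theorem HasWeakDiv.congr {n : ℕ} {Ω : Set (Eucl n)} {F F' : Fin n → Eucl n → ℝ}
    {w w' : Eucl n → ℝ} (h : HasWeakDiv Ω F w)
    (hF : ∀ i, F i =ᵐ[volume.restrict Ω] F' i) (hw : w =ᵐ[volume.restrict Ω] w') :
    HasWeakDiv Ω F' w' := by
  refine ⟨fun i => (h.1 i).congr (hF i), h.2.1.congr hw, fun φ hφ => ?_⟩
  have h1 : ∫ x in Ω, ∑ i, F' i x * partialD i φ x = ∫ x in Ω, ∑ i, F i x * partialD i φ x := by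
    refine integral_congr_ae ?_
    filter_upwards [ae_all_iff.2 hF] with x hx
    simp only [hx]
  have h2 : ∫ x in Ω, w' x * φ x = ∫ x in Ω, w x * φ x := by
    refine integral_congr_ae ?_
    filter_upwards [hw] with x hx
    simp only [hx]
  rw [h1, h2, h.2.2 φ hφ]

theorem HasWeakDiv.ae_unique {n : ℕ} {Ω : Set (Eucl n)} {F : Fin n → Eucl n → ℝ}
    {w w' : Eucl n → ℝ} (hΩ : IsOpen Ω) (h : HasWeakDiv Ω F w) (h' : HasWeakDiv Ω F w') :
    w =ᵐ[volume.restrict Ω] w' := by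
  have key := hΩ.ae_eq_zero_of_integral_contDiff_smul_eq_zero (μ := volume)
    (f := fun x => w x - w' x) (h.2.1.sub h'.2.1) (by
      intro g hg hgc hgs
      have hφ : IsTestFunction Ω g := ⟨hg, hgc, hgs⟩
      have e1 := h.2.2 g hφ
      rw [h'.2.2 g hφ] at e1
      rw [← setIntegral_eq_integral_of_forall_compl_eq_zero (s := Ω)]
      · have : (fun x => g x • (w x - w' x)) = fun x => w x * g x - w' x * g x := by
          funext x; simp; ring
        rw [this, integral_sub (h.integrable_right hφ) (h'.integrable_right hφ)]
        linarith
      · intro x hx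
        have : g x = 0 := by
          by_contra h0
          exact hx (hgs (subset_tsupport g h0))
        simp [this])
  refine (ae_restrict_iff' hΩ.measurableSet).2 ?_
  filter_upwards [key] with x hx hxΩ
  linarith [hx hxΩ]

theorem hasWeakDiv_weakDiv {n : ℕ} {Ω : Set (Eucl n)} {F : Fin n → Eucl n → ℝ}
    (h : ∃ w, HasWeakDiv Ω F w) : HasWeakDiv Ω F (weakDiv Ω F) := by
  rw [weakDiv, dif_pos h]
  exact h.choose_spec

theorem hasWeakPartial_weakPartial {n : ℕ} {Ω : Set (Eucl n)} {i : Fin n} {u : Eucl n → ℝ}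
    (h : ∃ w, HasWeakPartial Ω i u w) : HasWeakPartial Ω i u (weakPartial Ω i u) := by
  rw [weakPartial, dif_pos h]
  exact h.choose_spec

theorem hasWeakPartial_iff {n : ℕ} {Ω : Set (Eucl n)} {i : Fin n} {u w : Eucl n → ℝ} :
    HasWeakPartial Ω i u w ↔ HasWeakDiv Ω (fun j x => if j = i then u x else 0) w := by
  constructor
  · rintro ⟨h1, h2, h3⟩
    refine ⟨fun j => ?_, h2, fun φ hφ => ?_⟩
    · by_cases hj : j = i
      · simpa [hj] using h1
      · simpa [hj] using (locallyIntegrableOn_zero (ε'' := ℝ))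
    · simpa [ite_mul] using h3 φ hφ
  · rintro ⟨h1, h2, h3⟩
    refine ⟨by simpa using h1 i, h2, fun φ hφ => ?_⟩
    simpa [ite_mul] using h3 φ hφ

theorem HasWeakPartial.ae_unique {n : ℕ} {Ω : Set (Eucl n)} {i : Fin n} {u w w' : Eucl n → ℝ}
    (hΩ : IsOpen Ω) (h : HasWeakPartial Ω i u w) (h' : HasWeakPartial Ω i u w') :
    w =ᵐ[volume.restrict Ω] w' :=
  (hasWeakPartial_iff.1 h).ae_unique hΩ (hasWeakPartial_iff.1 h')

theorem HasWeakPartial.add {n : ℕ} {Ω : Set (Eucl n)} {i : Fin n} {u u' w w' : Eucl n → ℝ}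
    (h : HasWeakPartial Ω i u w) (h' : HasWeakPartial Ω i u' w') :
    HasWeakPartial Ω i (fun x => u x + u' x) (fun x => w x + w' x) := by
  rw [hasWeakPartial_iff] at *
  refine (h.add h').congr (fun j => Filter.Eventually.of_forall fun x => ?_) (by rfl)
  by_cases hj : j = i <;> simp [hj]

theorem HasWeakPartial.const_mul {n : ℕ} {Ω : Set (Eucl n)} {i : Fin n} {u w : Eucl n → ℝ}
    (h : HasWeakPartial Ω i u w) (c : ℝ) :
    HasWeakPartial Ω i (fun x => c * u x) (fun x => c * w x) := by
  rw [hasWeakPartial_iff] at *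
  refine (h.const_mul c).congr (fun j => Filter.Eventually.of_forall fun x => ?_) (by rfl)
  by_cases hj : j = i <;> simp [hj]

theorem HasWeakPartial.congr {n : ℕ} {Ω : Set (Eucl n)} {i : Fin n} {u u' w w' : Eucl n → ℝ}
    (h : HasWeakPartial Ω i u w) (hu : u =ᵐ[volume.restrict Ω] u')
    (hw : w =ᵐ[volume.restrict Ω] w') : HasWeakPartial Ω i u' w' := by
  rw [hasWeakPartial_iff] at *
  refine h.congr (fun j => ?_) hw
  filter_upwards [hu] with x hx
  simp [hx]

theorem HasWeakPartial.hasWeakDiv {n : ℕ} {Ω : Set (Eucl n)} {F W : Fin n → Eucl n → ℝ}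
    (h : ∀ i, HasWeakPartial Ω i (F i) (W i)) :
    HasWeakDiv Ω F (fun x => ∑ i, W i x) := by
  have h' : ∀ i, HasWeakDiv Ω (fun j x => if j = i then F i x else 0) (W i) :=
    fun i => hasWeakPartial_iff.1 (h i)
  refine ⟨fun i => (h i).1, ?_, fun φ hφ => ?_⟩
  · intro x hx
    choose t ht ht' using fun i => (h i).2.1 x hx
    refine ⟨⋂ i, t i, Filter.iInter_mem.2 ht, ?_⟩
    exact integrable_finsetSum _ fun i _ => (ht' i).mono_set (iInter_subset t i)
  have hL : ∀ i ∈ Finset.univ, Integrable (fun x => F i x * partialD i φ x)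
      (volume.restrict Ω) := fun i _ => by
    simpa [ite_mul] using (h' i).integrable_left hφ
  rw [integral_finsetSum _ hL]
  simp only [Finset.sum_mul]
  rw [integral_finsetSum _ (fun i _ => (h' i).integrable_right hφ), ← Finset.sum_neg_distrib]
  exact Finset.sum_congr rfl fun i _ => (h i).2.2 φ hφ

theorem MemSobolev.memLp {n : ℕ} {Ω : Set (Eucl n)} {k : ℕ} {p : ℝ≥0∞} {u : Eucl n → ℝ}
    (h : MemSobolev Ω k p u) : MemLp u p (volume.restrict Ω) := by
  cases k with
  | zero => exact h
  | succ k => exact h.1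

theorem MemSobolev.congr {n : ℕ} {Ω : Set (Eucl n)} {k : ℕ} {p : ℝ≥0∞} {u u' : Eucl n → ℝ}
    (h : MemSobolev Ω k p u) (hu : u =ᵐ[volume.restrict Ω] u') : MemSobolev Ω k p u' := by
  cases k with
  | zero => exact MemLp.ae_eq hu h
  | succ k =>
    refine ⟨h.1.ae_eq hu, fun i => ?_⟩
    obtain ⟨w, hw, hw'⟩ := h.2 i
    exact ⟨w, hw, hw'.congr hu (by rfl)⟩

theorem MemSobolev.add {n : ℕ} {Ω : Set (Eucl n)} {k : ℕ} {p : ℝ≥0∞} {u u' : Eucl n → ℝ}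
    (h : MemSobolev Ω k p u) (h' : MemSobolev Ω k p u') :
    MemSobolev Ω k p (fun x => u x + u' x) := by
  induction k generalizing u u' with
  | zero => exact MemLp.add h h'
  | succ k ih =>
    refine ⟨h.1.add h'.1, fun i => ?_⟩
    obtain ⟨w, hw, hw'⟩ := h.2 i
    obtain ⟨z, hz, hz'⟩ := h'.2 i
    exact ⟨_, ih hw hz, hw'.add hz'⟩

theorem MemSobolev.const_mul {n : ℕ} {Ω : Set (Eucl n)} {k : ℕ} {p : ℝ≥0∞} {u : Eucl n → ℝ}
    (h : MemSobolev Ω k p u) (c : ℝ) : MemSobolev Ω k p (fun x => c * u x) := by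
  induction k generalizing u with
  | zero => exact MemLp.const_mul h c
  | succ k ih =>
    refine ⟨h.1.const_mul c, fun i => ?_⟩
    obtain ⟨w, hw, hw'⟩ := h.2 i
    exact ⟨_, ih hw, hw'.const_mul c⟩

theorem MemSobolev.hasWeakPartial {n : ℕ} {Ω : Set (Eucl n)} {k : ℕ} {p : ℝ≥0∞}
    {u : Eucl n → ℝ} (h : MemSobolev Ω (k + 1) p u) (i : Fin n) :
    HasWeakPartial Ω i u (weakPartial Ω i u) := by
  obtain ⟨w, -, hw⟩ := h.2 i
  exact hasWeakPartial_weakPartial ⟨w, hw⟩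

theorem MemSobolev.weakPartial {n : ℕ} {Ω : Set (Eucl n)} (hΩ : IsOpen Ω) {k : ℕ} {p : ℝ≥0∞}
    {u : Eucl n → ℝ} (h : MemSobolev Ω (k + 1) p u) (i : Fin n) :
    MemSobolev Ω k p (weakPartial Ω i u) := by
  obtain ⟨w, hw, hw'⟩ := h.2 i
  exact hw.congr (hw'.ae_unique hΩ (h.hasWeakPartial i))

theorem MemSobolev.hasWeakDiv_weakLaplacian {n : ℕ} {Ω : Set (Eucl n)} (hΩ : IsOpen Ω)
    {p : ℝ≥0∞} {u : Eucl n → ℝ} (h : MemSobolev Ω 2 p u) :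
    HasWeakDiv Ω (fun i => _root_.weakPartial Ω i u) (weakLaplacian Ω u) :=
  HasWeakPartial.hasWeakDiv fun i => (h.weakPartial hΩ i).hasWeakPartial i

theorem MemSobolev.memLp_weakLaplacian {n : ℕ} {Ω : Set (Eucl n)} (hΩ : IsOpen Ω)
    {p : ℝ≥0∞} {u : Eucl n → ℝ} (h : MemSobolev Ω 2 p u) :
    MemLp (weakLaplacian Ω u) p (volume.restrict Ω) :=
  memLp_finsetSum _ fun i _ => ((h.weakPartial hΩ i).weakPartial hΩ i).memLp

/-- The integrals defining the normal trace make sense. -/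
theorem integrable_mul_of_isBounded {n : ℕ} {Ω : Set (Eucl n)} (hΩ : IsOpen Ω)
    (hb : Bornology.IsBounded Ω) {u v : Eucl n → ℝ} (hu : MemLp u 2 (volume.restrict Ω))
    (hv : Continuous v) : Integrable (fun x => u x * v x) (volume.restrict Ω) := by
  have : IsFiniteMeasure (volume.restrict Ω) := ⟨by simpa using hb.measure_lt_top⟩
  have hc : IsCompact (closure Ω) := hb.isCompact_closure
  obtain ⟨C, hC⟩ := hc.exists_bound_of_continuousOn hv.continuousOn
  refine Integrable.mul_bdd (c := C) (hu.integrable (by norm_num)) hv.aestronglyMeasurable ?_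
  exact (ae_restrict_iff' hΩ.measurableSet).2
    (Filter.Eventually.of_forall fun x hx => hC x (subset_closure hx))

theorem HasZeroNormalTrace.add {n : ℕ} {Ω : Set (Eucl n)} (hΩ : IsOpen Ω)
    (hb : Bornology.IsBounded Ω) {F F' : Fin n → Eucl n → ℝ} (h : HasZeroNormalTrace Ω F)
    (h' : HasZeroNormalTrace Ω F') : HasZeroNormalTrace Ω (fun i x => F i x + F' i x) := by
  obtain ⟨hF, w, hw, hd, ht⟩ := h
  obtain ⟨hF', w', hw', hd', ht'⟩ := h'
  refine ⟨fun i => (hF i).add (hF' i), _, hw.add hw', hd.add hd', fun v hv => ?_⟩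
  simp only [Pi.add_apply, add_mul, Finset.sum_add_distrib]
  rw [integral_add, integral_add, ← add_zero (0 : ℝ)]
  · nth_rewrite 1 [← ht v hv]
    rw [← ht' v hv]
    ring
  · exact integrable_mul_of_isBounded hΩ hb hw hv.continuous
  · exact integrable_mul_of_isBounded hΩ hb hw' hv.continuous
  · exact integrable_finsetSum _ fun i _ =>
      integrable_mul_of_isBounded hΩ hb (hF i) (continuous_partialD hv i)
  · exact integrable_finsetSum _ fun i _ =>
      integrable_mul_of_isBounded hΩ hb (hF' i) (continuous_partialD hv i)

theorem HasZeroNormalTrace.const_mul {n : ℕ} {Ω : Set (Eucl n)} {F : Fin n → Eucl n → ℝ}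
    (h : HasZeroNormalTrace Ω F) (c : ℝ) : HasZeroNormalTrace Ω (fun i x => c * F i x) := by
  obtain ⟨hF, w, hw, hd, ht⟩ := h
  refine ⟨fun i => (hF i).const_mul c, _, hw.const_mul c, hd.const_mul c, fun v hv => ?_⟩
  simp only [mul_assoc, ← Finset.mul_sum]
  rw [integral_const_mul, integral_const_mul, ← mul_add, ht v hv, mul_zero]

theorem HasZeroNormalTrace.congr {n : ℕ} {Ω : Set (Eucl n)} {F F' : Fin n → Eucl n → ℝ}
    (h : HasZeroNormalTrace Ω F) (hF' : ∀ i, F i =ᵐ[volume.restrict Ω] F' i) :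
    HasZeroNormalTrace Ω F' := by
  obtain ⟨hF, w, hw, hd, ht⟩ := h
  refine ⟨fun i => (hF i).ae_eq (hF' i), w, hw, hd.congr hF' (by rfl), fun v hv => ?_⟩
  rw [← ht v hv]
  congr 1
  refine integral_congr_ae ?_
  filter_upwards [ae_all_iff.2 hF'] with x hx
  simp only [hx]

/-! ### The Fokker–Planck operator -/

/-- The data of the Fokker–Planck equation: a bounded domain `Ω ⊂ ℝⁿ` with smooth boundary, a
diffusion constant `ν > 0` and a potential `G ∈ W^{1,∞}(Ω) ∩ W^{2,max(2,n)}(Ω)`. -/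
structure FokkerPlanckData (n : ℕ) where
  /-- the domain -/
  Ω : Set (Eucl n)
  /-- the diffusion constant -/
  ν : ℝ
  /-- the ground potential -/
  G : Eucl n → ℝ
  isOpen : IsOpen Ω
  isConnected : IsConnected Ω
  isBounded : Bornology.IsBounded Ω
  smoothBoundary : HasSmoothBoundary Ω
  ν_pos : 0 < ν
  G_mem₁ : MemSobolev Ω 1 ⊤ G
  G_mem₂ : MemSobolev Ω 2 (max 2 (n : ℝ≥0∞)) G

namespace FokkerPlanckData

/-- Lebesgue measure on `Ω`. -/
abbrev μ {n : ℕ} (S : FokkerPlanckData n) : Measure (Eucl n) := volume.restrict S.Ω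

instance {n : ℕ} (S : FokkerPlanckData n) : IsFiniteMeasure S.μ :=
  ⟨by simpa using S.isBounded.measure_lt_top⟩

/-- The state space `𝒴 = L²(Ω)` (real valued). -/
abbrev Y {n : ℕ} (S : FokkerPlanckData n) : Type := Lp ℝ 2 S.μ

/-- The vector field `ρ ∇G`. -/
def drift {n : ℕ} (S : FokkerPlanckData n) (ρ : Eucl n → ℝ) : Fin n → Eucl n → ℝ :=
  fun i x => ρ x * weakPartial S.Ω i S.G x

/-- The flux `ν ∇ρ + ρ ∇G`. -/
def flux {n : ℕ} (S : FokkerPlanckData n) (ρ : Eucl n → ℝ) : Fin n → Eucl n → ℝ :=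
  fun i x => S.ν * weakPartial S.Ω i ρ x + S.drift ρ i x

/-- The expression `ν Δρ + ∇ · (ρ ∇G)`. -/
def opA {n : ℕ} (S : FokkerPlanckData n) (ρ : Eucl n → ℝ) : Eucl n → ℝ :=
  fun x => S.ν * weakLaplacian S.Ω ρ x + weakDiv S.Ω (S.drift ρ) x

theorem flux_add {n : ℕ} (S : FokkerPlanckData n) {ρ σ τ : Eucl n → ℝ}
    (hρ : MemSobolev S.Ω 2 2 ρ) (hσ : MemSobolev S.Ω 2 2 σ)
    (hτ : (fun x => ρ x + σ x) =ᵐ[S.μ] τ) (i : Fin n) :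
    (fun x => S.flux ρ i x + S.flux σ i x) =ᵐ[S.μ] S.flux τ i := by
  have h1 := (hρ.hasWeakPartial i).add (hσ.hasWeakPartial i)
  have h2 := ((hρ.add hσ).congr hτ).hasWeakPartial i
  filter_upwards [(h1.congr hτ (by rfl)).ae_unique S.isOpen h2, hτ] with x hx hx'
  simp only [flux, drift, ← hx, ← hx']
  ring

theorem flux_const_mul {n : ℕ} (S : FokkerPlanckData n) {ρ τ : Eucl n → ℝ} (c : ℝ)
    (hρ : MemSobolev S.Ω 2 2 ρ) (hτ : (fun x => c * ρ x) =ᵐ[S.μ] τ) (i : Fin n) :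
    (fun x => c * S.flux ρ i x) =ᵐ[S.μ] S.flux τ i := by
  have h1 := (hρ.hasWeakPartial i).const_mul c
  have h2 := ((hρ.const_mul c).congr hτ).hasWeakPartial i
  filter_upwards [(h1.congr hτ (by rfl)).ae_unique S.isOpen h2, hτ] with x hx hx'
  simp only [flux, drift, ← hx, ← hx']
  ring

/-- `ν Δρ + ∇ · (ρ ∇G)` is the divergence of the flux. -/
theorem hasWeakDiv_flux {n : ℕ} (S : FokkerPlanckData n) {ρ : Eucl n → ℝ}
    (hρ : MemSobolev S.Ω 2 2 ρ) (h : HasZeroNormalTrace S.Ω (S.flux ρ)) :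
    HasWeakDiv S.Ω (S.flux ρ) (S.opA ρ) := by
  obtain ⟨-, w, -, hd, -⟩ := h
  have h1 := hρ.hasWeakDiv_weakLaplacian S.isOpen
  have h2 : HasWeakDiv S.Ω (S.drift ρ) _ :=
    (hd.add (h1.const_mul (-S.ν))).congr
      (fun i => Filter.Eventually.of_forall fun x => by simp [flux]) (by rfl)
  exact (h1.const_mul S.ν).add (hasWeakDiv_weakDiv ⟨_, h2⟩)

theorem memLp_opA {n : ℕ} (S : FokkerPlanckData n) {ρ : Eucl n → ℝ}
    (hρ : MemSobolev S.Ω 2 2 ρ) (h : HasZeroNormalTrace S.Ω (S.flux ρ)) :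
    MemLp (S.opA ρ) 2 S.μ := by
  have h1 := S.hasWeakDiv_flux hρ h
  obtain ⟨-, w, hw, hd, -⟩ := h
  exact hw.ae_eq (hd.ae_unique S.isOpen h1)

/-- The domain `𝒟(𝒜) = {ρ ∈ H²(Ω) | (ν ∇ρ + ρ ∇G) · n = 0 on ∂Ω}`. -/
def domA {n : ℕ} (S : FokkerPlanckData n) : Submodule ℝ S.Y where
  carrier := {ρ | MemSobolev S.Ω 2 2 ρ ∧ HasZeroNormalTrace S.Ω (S.flux ρ)}
  add_mem' := by
    rintro ρ σ ⟨h1, h2⟩ ⟨h3, h4⟩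
    have e : (fun x => ρ x + σ x) =ᵐ[S.μ] (ρ + σ : S.Y) := (Lp.coeFn_add ρ σ).symm
    exact ⟨(h1.add h3).congr e,
      (h2.add S.isOpen S.isBounded h4).congr (S.flux_add h1 h3 e)⟩
  zero_mem' := by
    have h0 : HasWeakDiv S.Ω (fun _ _ => 0) (fun _ => 0) :=
      ⟨fun _ => locallyIntegrableOn_zero, locallyIntegrableOn_zero, by simp⟩
    have hp : ∀ i, HasWeakPartial S.Ω i (fun _ => 0) (fun _ => 0) := fun i =>
      hasWeakPartial_iff.2 (by simpa using h0)
    have hs : MemSobolev S.Ω 2 2 (fun _ => (0 : ℝ)) :=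
      ⟨MemLp.zero', fun i => ⟨_, ⟨MemLp.zero', fun j => ⟨_, MemLp.zero', hp j⟩⟩, hp i⟩⟩
    have ht : HasZeroNormalTrace S.Ω (fun _ _ => 0) :=
      ⟨fun _ => MemLp.zero', _, MemLp.zero', h0, by simp⟩
    have e : (fun _ => (0 : ℝ)) =ᵐ[S.μ] (0 : S.Y) := (Lp.coeFn_zero ℝ 2 S.μ).symm
    refine ⟨hs.congr e, ht.congr fun i => ?_⟩
    have := S.flux_const_mul 0 hs (τ := (0 : S.Y)) (by simpa using e) i
    simpa using this
  smul_mem' := by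
    rintro c ρ ⟨h1, h2⟩
    have e : (fun x => c * ρ x) =ᵐ[S.μ] (c • ρ : S.Y) := (Lp.coeFn_smul c ρ).symm
    exact ⟨(h1.const_mul c).congr e, (h2.const_mul c).congr (S.flux_const_mul c h1 e)⟩

theorem opA_add {n : ℕ} (S : FokkerPlanckData n) (ρ σ : S.domA) :
    S.opA ((ρ + σ : S.domA) : S.Y) =ᵐ[S.μ]
      fun x => S.opA (ρ : S.Y) x + S.opA (σ : S.Y) x := by
  have e : (fun x => (ρ : S.Y) x + (σ : S.Y) x) =ᵐ[S.μ] ((ρ + σ : S.domA) : S.Y) :=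
    (Lp.coeFn_add (ρ : S.Y) σ).symm
  exact (S.hasWeakDiv_flux (ρ + σ).2.1 (ρ + σ).2.2).ae_unique S.isOpen
    (((S.hasWeakDiv_flux ρ.2.1 ρ.2.2).add (S.hasWeakDiv_flux σ.2.1 σ.2.2)).congr
      (S.flux_add ρ.2.1 σ.2.1 e) (by rfl))

theorem opA_smul {n : ℕ} (S : FokkerPlanckData n) (c : ℝ) (ρ : S.domA) :
    S.opA ((c • ρ : S.domA) : S.Y) =ᵐ[S.μ] fun x => c * S.opA (ρ : S.Y) x := by
  have e : (fun x => c * (ρ : S.Y) x) =ᵐ[S.μ] ((c • ρ : S.domA) : S.Y) :=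
    (Lp.coeFn_smul c (ρ : S.Y)).symm
  exact (S.hasWeakDiv_flux (c • ρ).2.1 (c • ρ).2.2).ae_unique S.isOpen
    (((S.hasWeakDiv_flux ρ.2.1 ρ.2.2).const_mul c).congr
      (S.flux_const_mul c ρ.2.1 e) (by rfl))

/-- The function `ν Δρ + ∇ · (ρ ∇G)` as an element of `L²(Ω)`, for `ρ ∈ 𝒟(𝒜)`. -/
def opALp {n : ℕ} (S : FokkerPlanckData n) (ρ : S.domA) : S.Y :=
  (S.memLp_opA ρ.2.1 ρ.2.2).toLp (S.opA (ρ : S.Y))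

theorem coeFn_opALp {n : ℕ} (S : FokkerPlanckData n) (ρ : S.domA) :
    S.opALp ρ =ᵐ[S.μ] S.opA (ρ : S.Y) := (S.memLp_opA ρ.2.1 ρ.2.2).coeFn_toLp

/-- The Fokker–Planck operator
`𝒜ρ = ν Δρ + ∇ · (ρ ∇G)`, `𝒟(𝒜) = {ρ ∈ H²(Ω) | (ν ∇ρ + ρ ∇G) · n = 0 on ∂Ω}`,
as an unbounded operator in `L²(Ω)`. -/
def A {n : ℕ} (S : FokkerPlanckData n) : S.Y →ₗ.[ℝ] S.Y where
  domain := S.domA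
  toFun :=
    { toFun := S.opALp
      map_add' := fun ρ σ => by
        apply Lp.ext
        filter_upwards [S.opA_add ρ σ, S.coeFn_opALp ρ, S.coeFn_opALp σ, S.coeFn_opALp (ρ + σ),
          Lp.coeFn_add (S.opALp ρ) (S.opALp σ)] with x h1 h2 h3 h4 h5
        rw [h4, h1, h5, Pi.add_apply, h2, h3]
      map_smul' := fun c ρ => by
        apply Lp.ext
        filter_upwards [S.opA_smul c ρ, S.coeFn_opALp ρ, S.coeFn_opALp (c • ρ),
          Lp.coeFn_smul c (S.opALp ρ)] with x h1 h2 h3 h4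
        rw [h3, h1, RingHom.id_apply, h4, Pi.smul_apply, h2, smul_eq_mul] }

/-- The adjoint `𝒜*` of the unbounded operator `𝒜` in `L²(Ω)`. -/
def Astar {n : ℕ} (S : FokkerPlanckData n) : S.Y →ₗ.[ℝ] S.Y := LinearPMap.adjoint S.A

/-! ### The stationary distribution and the projections -/

/-- `Φ = log ν + G / ν`. -/
def Φ {n : ℕ} (S : FokkerPlanckData n) : Eucl n → ℝ := fun x => Real.log S.ν + S.G x / S.ν

/-- The stationary state `ρ_∞ = e^{-Φ}`, normalized to `∫_Ω ρ_∞ = 1`. -/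
def rhoInfFun {n : ℕ} (S : FokkerPlanckData n) : Eucl n → ℝ :=
  fun x => Real.exp (-S.Φ x) / ∫ y in S.Ω, Real.exp (-S.Φ y)

theorem memLp_exp {n : ℕ} (S : FokkerPlanckData n) (p : ℝ≥0∞) :
    MemLp (fun x => Real.exp (-S.Φ x)) p S.μ := by
  have hG : MemLp S.G ⊤ S.μ := S.G_mem₁.memLp
  have hG' : ∀ᵐ x ∂S.μ, ‖S.G x‖ ≤ (eLpNormEssSup S.G S.μ).toReal := by
    have hlt : eLpNormEssSup S.G S.μ < ⊤ := by simpa using hG.2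
    filter_upwards [ae_le_eLpNormEssSup (f := S.G) (μ := S.μ)] with x hx
    rw [← toReal_enorm]
    exact ENNReal.toReal_mono hlt.ne hx
  refine MemLp.of_bound (C := Real.exp (-Real.log S.ν +
    (eLpNormEssSup S.G S.μ).toReal / S.ν)) ?_ ?_
  · exact Real.continuous_exp.comp_aestronglyMeasurable
      ((aestronglyMeasurable_const.add (by simpa only [div_eq_mul_inv] using hG.1.mul_const S.ν⁻¹)).neg)
  · filter_upwards [hG'] with x hx
    rw [Real.norm_eq_abs, Real.abs_exp, Real.exp_le_exp, Φ]
    have h1 : -S.G x / S.ν ≤ (eLpNormEssSup S.G S.μ).toReal / S.ν := by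
      gcongr
      · exact S.ν_pos.le
      · exact (neg_le_abs _).trans hx
    rw [neg_div] at h1
    linarith

theorem memLp_rhoInfFun {n : ℕ} (S : FokkerPlanckData n) : MemLp S.rhoInfFun 2 S.μ := by
  have := (S.memLp_exp 2).mul_const (∫ y in S.Ω, Real.exp (-S.Φ y))⁻¹
  exact this

/-- `ρ_∞` as an element of `L²(Ω)`. -/
def rhoInf {n : ℕ} (S : FokkerPlanckData n) : S.Y := S.memLp_rhoInfFun.toLp S.rhoInfFun

theorem integral_rhoInfFun {n : ℕ} (S : FokkerPlanckData n) :
    ∫ x in S.Ω, S.rhoInfFun x = 1 := by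
  have h : 0 < ∫ y in S.Ω, Real.exp (-S.Φ y) := by
    have : NeZero S.μ := ⟨by
      rw [Ne, Measure.restrict_eq_zero]
      exact (S.isOpen.measure_pos volume S.isConnected.nonempty).ne'⟩
    exact integral_exp_pos ((S.memLp_exp 1).integrable le_rfl)
  simp only [rhoInfFun]
  rw [integral_div, div_self h.ne']

/-- The constant function `𝟙` in `L²(Ω)`. -/
def one {n : ℕ} (S : FokkerPlanckData n) : S.Y := (memLp_const (1 : ℝ)).toLp (fun _ => (1 : ℝ))

theorem inner_one {n : ℕ} (S : FokkerPlanckData n) (y : S.Y) :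
    ⟪S.one, y⟫_ℝ = ∫ x in S.Ω, y x := by
  rw [L2.inner_def]
  refine integral_congr_ae ?_
  filter_upwards [(memLp_const (1 : ℝ) : MemLp (fun _ => (1 : ℝ)) 2 S.μ).coeFn_toLp] with x hx
  rw [one, hx]
  simp

/-- The projection `𝒫` onto `𝟙^⊥` along `ρ_∞`: `𝒫y = y - (∫_Ω y) ρ_∞` (recall that
`⟪𝟙, y⟫ = ∫_Ω y`). -/
def P {n : ℕ} (S : FokkerPlanckData n) : S.Y →L[ℝ] S.Y :=
  ContinuousLinearMap.id ℝ S.Y - (innerSL ℝ S.one).smulRight S.rhoInf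

theorem P_apply {n : ℕ} (S : FokkerPlanckData n) (y : S.Y) :
    S.P y = y - (∫ x in S.Ω, y x) • S.rhoInf := by
  simp [P, inner_one]

/-- The adjoint `𝒫*` of `𝒫` in `L²(Ω)`. -/
def Pstar {n : ℕ} (S : FokkerPlanckData n) : S.Y →L[ℝ] S.Y := ContinuousLinearMap.adjoint S.P

/-- The closed subspace `𝒴_𝒫 = im 𝒫 = 𝟙^⊥ = {v ∈ L²(Ω) | ∫_Ω v = 0}`. -/
abbrev YP {n : ℕ} (S : FokkerPlanckData n) : Submodule ℝ S.Y := (ℝ ∙ S.one)ᗮ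

theorem mem_YP {n : ℕ} (S : FokkerPlanckData n) (v : S.Y) : v ∈ S.YP ↔ ∫ x in S.Ω, v x = 0 := by
  rw [Submodule.mem_orthogonal_singleton_iff_inner_right, inner_one]

/-- The orthogonal projection `Θ` of `L²(Ω)` onto `𝒴_𝒫`. -/
def Θ {n : ℕ} (S : FokkerPlanckData n) : S.Y →L[ℝ] S.YP := S.YP.orthogonalProjectionOnto

/-- `𝒜` maps into `𝒴_𝒫`. -/
theorem A_mem_YP {n : ℕ} (S : FokkerPlanckData n) (ρ : S.A.domain) : S.A ρ ∈ S.YP := by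
  rw [mem_YP]
  obtain ⟨ρ, h1, h2⟩ := ρ
  have e : ∀ᵐ x ∂S.μ, S.A ⟨ρ, h1, h2⟩ x = S.opA ρ x := S.coeFn_opALp ⟨ρ, h1, h2⟩
  rw [integral_congr_ae e]
  have h3 := S.hasWeakDiv_flux h1 h2
  obtain ⟨-, w, -, hd, ht⟩ := h2
  have h4 := ht (fun _ => 1) contDiff_const
  rw [integral_congr_ae (h3.ae_unique S.isOpen hd)]
  simpa [partialD] using h4

/-- The restriction `𝒜̂ = 𝒜 I_𝒫` of `𝒜` to `𝒟(𝒜̂) = 𝒟(𝒜) ∩ 𝒴_𝒫`, as an unbounded operator in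
`𝒴_𝒫`. -/
def Ahat {n : ℕ} (S : FokkerPlanckData n) : S.YP →ₗ.[ℝ] S.YP where
  domain := S.A.domain.comap S.YP.subtype
  toFun :=
    { toFun := fun y => ⟨S.A ⟨(y : S.YP), y.2⟩, S.A_mem_YP _⟩
      map_add' := fun y z => Subtype.ext (S.A.map_add ⟨(y : S.YP), y.2⟩ ⟨(z : S.YP), z.2⟩)
      map_smul' := fun c y => Subtype.ext (S.A.map_smul c ⟨(y : S.YP), y.2⟩) }

/-- The operator `𝒜^♯ φ = Θ 𝒜* φ` with `𝒟(𝒜^♯) = 𝒟(𝒜*) ∩ 𝒴_𝒫`, in `𝒴_𝒫`. -/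
def Asharp {n : ℕ} (S : FokkerPlanckData n) : S.YP →ₗ.[ℝ] S.YP where
  domain := S.Astar.domain.comap S.YP.subtype
  toFun :=
    { toFun := fun φ => S.Θ (S.Astar ⟨(φ : S.YP), φ.2⟩)
      map_add' := fun y z => by
        rw [← map_add, ← LinearPMap.map_add]; rfl
      map_smul' := fun c y => by
        rw [RingHom.id_apply, ← map_smul, ← LinearPMap.map_smul]; rfl }

end FokkerPlanckData

/-- `(r, x)` is an eigenpair of the (unbounded) operator `T`: `x` is a nonzero element of the
domain with `T x = r x`. -/
def IsEigenpair {E : Type*} [AddCommGroup E] [Module ℝ E] (T : E →ₗ.[ℝ] E) (r : ℝ) (x : E) :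
    Prop :=
  x ≠ 0 ∧ ∃ hx : x ∈ T.domain, T ⟨x, hx⟩ = r • x

end

/-! The whole statement rests on two facts about kernels. First, mass is conserved: testing the zero
normal trace with the constant function gives `∫ 𝒜ρ = 0`, so `𝟙` lies in the kernel of `𝒜*`. Both
`Θ` and `𝒫*` alter a function only by a multiple of `𝟙`, so neither of them changes the value of
`𝒜*` (`coe_Θ`, `Pstar_apply`, `Astar_sub_smul_one`). Second, `𝒜ρ_∞ = 0`. If `Θ𝒜*φ = λφ`, then `𝒜*φ =
λφ + c𝟙`, and pairing with `ρ_∞` forces `c = -λ⟪ρ_∞, φ⟫`, which says `𝒜*φ = λ𝒫*φ`. The converse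
passage applies `Θ` to `𝒜*Θφ = 𝒜*φ = λφ`.

For the adjoint identity, density of `𝒟(𝒜)` provides `d ∈ 𝒟(𝒜)` with `⟪𝟙, d⟫ = 1`. The skew
projection `y ↦ y - ⟪𝟙, y⟫d` onto `𝒴_𝒫` preserves `𝒟(𝒜)`; it transfers density to `𝒟(𝒜̂)` and
extends a bounded functional from `𝒟(𝒜̂)` to `𝒟(𝒜)` (`adjoint_Ahat`).

The analytic input is therefore density of `𝒟(𝒜)` and `ρ_∞ ∈ ker 𝒜`. Test functions belong to `𝒟(𝒜)`
because their flux has compact support in `Ω` (`dense_domain_A`). For `ρ_∞`, the weak chain and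
product rule `HasWeakPartial.comp_mul`, proved by mollification, gives `ν∇e^{-Φ} = -e^{-Φ}∇G`; thus
the flux vanishes identically, and a second application gives `H²` regularity. -/

/-! ### Mollification of bounded functions with bounded weak derivatives -/

open Filter Topology Convolution ContinuousLinearMap in
theorem ContDiffBump.abs_normed_convolution_le {n : ℕ} (φ : ContDiffBump (0 : Eucl n))
    {f : Eucl n → ℝ} {C : ℝ} (hf : ∀ᵐ x, |f x| ≤ C) (x : Eucl n) :
    |(φ.normed volume ⋆[lsmul ℝ ℝ, volume] f) x| ≤ C := by
  have hf' : ∀ᵐ t, |f (x - t)| ≤ C :=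
    (Measure.measurePreserving_sub_left volume x).quasiMeasurePreserving.ae hf
  have h := norm_integral_le_of_norm_le (μ := volume)
    (f := fun t => lsmul ℝ ℝ (φ.normed volume t) (f (x - t))) (φ.integrable_normed.mul_const C) (by
      filter_upwards [hf'] with t ht
      rw [lsmul_apply, norm_smul, Real.norm_of_nonneg (φ.nonneg_normed t)]
      exact mul_le_mul_of_nonneg_left ht (φ.nonneg_normed t))
  rwa [integral_mul_const, φ.integral_normed, one_mul] at h

-- The derivative falls on the bump, and `t ↦ ψ(x - t)` is a test function on `Ω` as soon as the
-- closed ball about `x` stays in `Ω`. The sign from reflecting the bump cancels the sign in the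
-- definition of the weak derivative.
open Filter Topology Convolution ContinuousLinearMap in
theorem HasWeakPartial.partialD_normed_convolution {n : ℕ} {Ω : Set (Eucl n)} {j : Fin n}
    {u w : Eucl n → ℝ} (hΩ : IsOpen Ω) (h : HasWeakPartial Ω j u w)
    (hu : LocallyIntegrable (Ω.indicator u)) (φ : ContDiffBump (0 : Eucl n)) {x : Eucl n}
    (hx : Metric.closedBall x φ.rOut ⊆ Ω) :
    partialD j (φ.normed volume ⋆[lsmul ℝ ℝ, volume] Ω.indicator u) x =
      (φ.normed volume ⋆[lsmul ℝ ℝ, volume] Ω.indicator w) x := by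
  set ψ : Eucl n → ℝ := φ.normed volume with hψ
  have hψd : ContDiff ℝ ∞ ψ := φ.contDiff_normed
  have hψc : HasCompactSupport ψ := φ.hasCompactSupport_normed
  have hη : IsTestFunction Ω (fun t => ψ (x - t)) := by
    have hs : tsupport (fun t => ψ (x - t)) ⊆ Metric.closedBall x φ.rOut := by
      refine closure_minimal (fun t ht => ?_) Metric.isClosed_closedBall
      have h1 : x - t ∈ Function.support (φ.normed volume) := ht
      rw [φ.support_normed_eq, mem_ball_zero_iff] at h1
      rw [Metric.mem_closedBall', dist_eq_norm]
      exact h1.le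
    exact ⟨hψd.comp (contDiff_const.sub contDiff_id),
      (isCompact_closedBall x φ.rOut).of_isClosed_subset (isClosed_tsupport _) hs, hs.trans hx⟩
  have hd : ∀ t, partialD j (fun t => ψ (x - t)) t = -partialD j ψ (x - t) := fun t => by
    have h1 : HasFDerivAt (fun t : Eucl n => x - t) (-ContinuousLinearMap.id ℝ (Eucl n)) t :=
      (hasFDerivAt_id t).const_sub x
    have h2 := ((hψd.differentiable (by simp)) (x - t)).hasFDerivAt.comp t h1
    have h3 : fderiv ℝ (fun t => ψ (x - t)) t = _ := h2.fderiv
    rw [partialD, h3]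
    simp [partialD]
  -- The rule used differentiates the right factor, so the bilinear map is flipped to put the bump
  -- there.
  have hfd := hψc.hasFDerivAt_convolution_right (lsmul ℝ ℝ).flip hu
    (hψd.of_le (by simp)) x
  rw [convolution_flip] at hfd
  have e0 : (ψ ⋆[lsmul ℝ ℝ, volume] Ω.indicator w) x =
      (Ω.indicator w ⋆[(lsmul ℝ ℝ).flip, volume] ψ) x := by rw [convolution_flip]
  rw [e0, partialD, hfd.fderiv, convolution_precompR_apply _ hu (hψc.fderiv ℝ)
    (hψd.continuous_fderiv (by simp)), convolution_def, convolution_def]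
  have hd' : ∀ t, fderiv ℝ ψ (x - t) (EuclideanSpace.single j 1) =
      -partialD j (fun t => ψ (x - t)) t := fun t => by rw [hd, neg_neg, partialD]
  have e1 : ∀ t, ((lsmul ℝ ℝ : ℝ →L[ℝ] ℝ →L[ℝ] ℝ).flip (Ω.indicator u t))
      (fderiv ℝ ψ (x - t) (EuclideanSpace.single j 1)) =
      Ω.indicator (fun t => -(u t * partialD j (fun t => ψ (x - t)) t)) t := fun t => by
    by_cases ht : t ∈ Ω <;> simp [ht, hd', mul_comm]
  have e2 : ∀ t, ((lsmul ℝ ℝ : ℝ →L[ℝ] ℝ →L[ℝ] ℝ).flip (Ω.indicator w t)) (ψ (x - t)) =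
      Ω.indicator (fun t => w t * ψ (x - t)) t := fun t => by
    by_cases ht : t ∈ Ω <;> simp [ht, mul_comm]
  simp only [e1, e2]
  rw [integral_indicator hΩ.measurableSet, integral_indicator hΩ.measurableSet, integral_neg,
    h.2.2 _ hη, neg_neg]

theorem MeasureTheory.MemLp.exists_ae_abs_le {α : Type*} [MeasurableSpace α] {μ : Measure α} {f : α → ℝ}
    (hf : MemLp f ⊤ μ) : ∃ C, ∀ᵐ x ∂μ, |f x| ≤ C := by
  have hlt : eLpNormEssSup f μ < ⊤ := by simpa using hf.2
  refine ⟨(eLpNormEssSup f μ).toReal, ?_⟩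
  filter_upwards [ae_le_eLpNormEssSup (f := f) (μ := μ)] with x hx
  rw [← Real.norm_eq_abs, ← toReal_enorm]
  exact ENNReal.toReal_mono hlt.ne hx

-- Mollify the extension of `u` by zero, at radii small enough that balls about points of `K` remain
-- in `Ω`. The bounds hold because mollification is averaging, the limits by Lebesgue
-- differentiation. Derivatives are controlled only on `K`, since the extension may jump across the
-- boundary. The conclusion is tailored to dominated convergence.
open Filter Topology Convolution ContinuousLinearMap in
theorem HasWeakPartial.exists_smooth_approx {n : ℕ} {Ω : Set (Eucl n)} {j : Fin n}
    {u w : Eucl n → ℝ} (hΩ : IsOpen Ω) (hu : MemLp u ⊤ (volume.restrict Ω))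
    (hw : MemLp w ⊤ (volume.restrict Ω)) (h : HasWeakPartial Ω j u w) {K : Set (Eucl n)}
    (hK : IsCompact K) (hKΩ : K ⊆ Ω) :
    ∃ (U : ℕ → Eucl n → ℝ) (C : ℝ), (∀ k, ContDiff ℝ ∞ (U k)) ∧ (∀ k x, |U k x| ≤ C) ∧
      (∀ k, ∀ x ∈ K, |partialD j (U k) x| ≤ C) ∧
      (∀ᵐ x ∂volume.restrict Ω, Tendsto (fun k => U k x) atTop (𝓝 (u x))) ∧
      ∀ᵐ x ∂volume.restrict Ω, x ∈ K →
        Tendsto (fun k => partialD j (U k) x) atTop (𝓝 (w x)) := by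
  have ind : ∀ {f : Eucl n → ℝ}, MemLp f ⊤ (volume.restrict Ω) →
      LocallyIntegrable (Ω.indicator f) ∧ ∃ C, ∀ᵐ x, |Ω.indicator f x| ≤ C := fun hf => by
    have h1 := (memLp_indicator_iff_restrict hΩ.measurableSet).2 hf
    exact ⟨h1.locallyIntegrable le_top, MemLp.exists_ae_abs_le h1⟩
  obtain ⟨hui, Cu, hCu⟩ := ind hu
  obtain ⟨hwi, Cw, hCw⟩ := ind hw
  obtain ⟨δ, hδ, hδΩ⟩ := hK.exists_cthickening_subset_open hΩ hKΩ
  have hδk : ∀ k : ℕ, 0 < δ / (k + 1) := fun k => by positivity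
  let B : ℕ → ContDiffBump (0 : Eucl n) := fun k =>
    ⟨δ / (k + 1) / 2, δ / (k + 1), half_pos (hδk k), half_lt_self (hδk k)⟩
  have hB0 : Tendsto (fun k => (B k).rOut) atTop (𝓝 0) := by
    have h0 := (tendsto_const_div_atTop_nhds_zero_nat δ).comp (tendsto_add_atTop_nat 1)
    refine h0.congr fun k => ?_
    simp [B]
  -- Comparable inner and outer radii keep the bumps comparable to averages over balls, as Lebesgue
  -- differentiation requires.
  have hB2 : ∀ᶠ k in atTop, (B k).rOut ≤ 2 * (B k).rIn :=
    Eventually.of_forall fun k => by simp only [B]; linarith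
  have hBK : ∀ k, ∀ x ∈ K, Metric.closedBall x (B k).rOut ⊆ Ω := fun k x hx =>
    ((Metric.closedBall_subset_closedBall
      (div_le_self hδ.le (by linarith [k.cast_nonneg (α := ℝ)]))).trans
      (Metric.closedBall_subset_cthickening hx δ)).trans hδΩ
  have hder : ∀ k, ∀ x ∈ K, _ := fun k x hx =>
    h.partialD_normed_convolution hΩ hui (B k) (hBK k x hx)
  refine ⟨fun k => (B k).normed volume ⋆[lsmul ℝ ℝ, volume] Ω.indicator u, max Cu Cw,
    fun k => (B k).hasCompactSupport_normed.contDiff_convolution_left _ (B k).contDiff_normed hui,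
    fun k x => ((B k).abs_normed_convolution_le hCu x).trans (le_max_left _ _),
    fun k x hx => ?_, ?_, ?_⟩
  · rw [hder k x hx]
    exact ((B k).abs_normed_convolution_le hCw x).trans (le_max_right _ _)
  · refine (ae_restrict_iff' hΩ.measurableSet).2 ?_
    filter_upwards [ContDiffBump.ae_convolution_tendsto_right_of_locallyIntegrable hB0 hB2 hui]
      with x hx hxΩ
    simpa [hxΩ] using hx
  · refine (ae_restrict_iff' hΩ.measurableSet).2 ?_
    filter_upwards [ContDiffBump.ae_convolution_tendsto_right_of_locallyIntegrable hB0 hB2 hwi]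
      with x hx hxΩ hxK
    simp only [hder _ x hxK]
    simpa [hxΩ] using hx

/-! ### Chain and product rules for weak derivatives -/

theorem partialD_mul {n : ℕ} {f g : Eucl n → ℝ} (hf : ContDiff ℝ ∞ f) (hg : ContDiff ℝ ∞ g)
    (i : Fin n) (x : Eucl n) :
    partialD i (fun y => f y * g y) x = f x * partialD i g x + partialD i f x * g x := by
  have hf' := (hf.differentiable (by simp)) x
  have hg' := (hg.differentiable (by simp)) x
  rw [partialD, fderiv_fun_mul hf' hg']
  simp [partialD, mul_comm]

theorem partialD_comp {n : ℕ} {f : ℝ → ℝ} {g : Eucl n → ℝ} (hf : ContDiff ℝ ∞ f)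
    (hg : ContDiff ℝ ∞ g) (i : Fin n) (x : Eucl n) :
    partialD i (fun y => f (g y)) x = deriv f (g x) * partialD i g x := by
  have hf' := ((hf.differentiable (by simp)) (g x)).hasDerivAt
  have hg' := ((hg.differentiable (by simp)) x).hasFDerivAt
  have h : fderiv ℝ (fun y => f (g y)) x = _ := (hf'.comp_hasFDerivAt x hg').fderiv
  rw [partialD, h]
  simp [partialD]

theorem contDiff_partialD {n : ℕ} {φ : Eucl n → ℝ} (h : ContDiff ℝ ∞ φ) (i : Fin n) :
    ContDiff ℝ ∞ (partialD i φ) :=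
  (h.fderiv_right (m := ∞) (by simp)).clm_apply contDiff_const

theorem IsTestFunction.partialD {n : ℕ} {Ω : Set (Eucl n)} {φ : Eucl n → ℝ}
    (h : IsTestFunction Ω φ) (i : Fin n) : IsTestFunction Ω (partialD i φ) :=
  ⟨contDiff_partialD h.1 i,
    h.2.1.of_isClosed_subset (isClosed_tsupport _) (tsupport_partialD_subset φ i),
    (tsupport_partialD_subset φ i).trans h.2.2⟩

theorem IsTestFunction.mul_left {n : ℕ} {Ω : Set (Eucl n)} {η φ : Eucl n → ℝ}
    (h : IsTestFunction Ω φ) (hη : ContDiff ℝ ∞ η) : IsTestFunction Ω (fun x => η x * φ x) :=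
  ⟨hη.mul h.1, h.2.1.mul_left, (closure_mono fun _ hx => right_ne_zero_of_mul hx).trans h.2.2⟩

theorem MeasureTheory.LocallyIntegrableOn.bdd_mul {n : ℕ} {Ω : Set (Eucl n)} (hΩ : IsOpen Ω)
    {b v : Eucl n → ℝ} (hb : MemLp b ⊤ (volume.restrict Ω)) (hv : LocallyIntegrableOn v Ω) :
    LocallyIntegrableOn (fun x => b x * v x) Ω := by
  obtain ⟨C, hC⟩ := MemLp.exists_ae_abs_le hb
  rw [locallyIntegrableOn_iff hΩ.isLocallyClosed] at hv ⊢
  intro K hK hKc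
  refine Integrable.bdd_mul (c := C) (hv K hK hKc) (hb.1.mono_measure ?_) ?_
  · exact Measure.restrict_mono hK le_rfl
  · exact ae_restrict_of_ae_restrict_of_subset hK hC

theorem MeasureTheory.MemLp.continuous_comp_top {α : Type*} [MeasurableSpace α] {μ : Measure α} {u : α → ℝ}
    {f : ℝ → ℝ} (hu : MemLp u ⊤ μ) (hf : Continuous f) : MemLp (fun x => f (u x)) ⊤ μ := by
  obtain ⟨C, hC⟩ := MemLp.exists_ae_abs_le hu
  obtain ⟨M, hM⟩ := (isCompact_Icc (a := -C) (b := C)).exists_bound_of_continuousOn hf.continuousOn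
  exact memLp_top_of_bound (hf.comp_aestronglyMeasurable hu.1) M
    (hC.mono fun x hx => hM _ (abs_le.1 hx))

open Filter Topology in
/-- Chain and product rule for weak partial derivatives. -/
theorem HasWeakPartial.comp_mul {n : ℕ} {Ω : Set (Eucl n)} {j : Fin n}
    {u w v z : Eucl n → ℝ} (hΩ : IsOpen Ω) (hu : MemLp u ⊤ (volume.restrict Ω))
    (hw : MemLp w ⊤ (volume.restrict Ω)) (h : HasWeakPartial Ω j u w)
    (hv : HasWeakPartial Ω j v z) {f : ℝ → ℝ} (hf : ContDiff ℝ ∞ f) :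
    HasWeakPartial Ω j (fun x => f (u x) * v x)
      (fun x => deriv f (u x) * w x * v x + f (u x) * z x) := by
  have hfc' : Continuous (deriv f) := hf.continuous_deriv (by simp)
  have l1 : LocallyIntegrableOn (fun x => f (u x) * v x) Ω :=
    LocallyIntegrableOn.bdd_mul hΩ (MemLp.continuous_comp_top hu hf.continuous) hv.1
  have l2 : LocallyIntegrableOn (fun x => deriv f (u x) * w x * v x + f (u x) * z x) Ω :=
    (LocallyIntegrableOn.bdd_mul hΩ (hw.mul' (MemLp.continuous_comp_top hu hfc')) hv.1).add
      (LocallyIntegrableOn.bdd_mul hΩ (MemLp.continuous_comp_top hu hf.continuous) hv.2.1)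
  refine ⟨l1, l2, fun φ hφ => ?_⟩
  have hφ' := hφ.partialD j
  obtain ⟨U, C, hU, hUC, hUC', hUt, hUt'⟩ := h.exists_smooth_approx hΩ hu hw hφ.2.1 hφ.2.2
  -- All approximants take values in `[-C, C]`, so `f` and its derivative need to be bounded only
  -- there; this admits exponentials.
  obtain ⟨M, hM⟩ := (isCompact_Icc (a := -C) (b := C)).exists_bound_of_continuousOn
    hf.continuous.continuousOn
  obtain ⟨M', hM'⟩ := (isCompact_Icc (a := -C) (b := C)).exists_bound_of_continuousOn
    hfc'.continuousOn
  have hbM : ∀ k x, |f (U k x)| ≤ M := fun k x => hM _ (abs_le.1 (hUC k x))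
  have hbM' : ∀ k x, |deriv f (U k x)| ≤ M' := fun k x => hM' _ (abs_le.1 (hUC k x))
  have hM0' : 0 ≤ M' := (abs_nonneg _).trans (hbM' 0 0)
  have iv := integrable_mul_of_tsupport_subset hv.1 hφ.1.continuous hφ.2.1 hφ.2.2
  have ivd := integrable_mul_of_tsupport_subset hv.1 hφ'.1.continuous hφ'.2.1 hφ'.2.2
  have iz := integrable_mul_of_tsupport_subset hv.2.1 hφ.1.continuous hφ.2.1 hφ.2.2
  -- The integrand from testing the weak derivative of `v` with `f(U k) φ`. Its integral is zero for
  -- every `k`, and the limit `k → ∞` is the claim. Only `u` is mollified; `v` may be merely locally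
  -- integrable.
  let F : ℕ → Eucl n → ℝ := fun k x => f (U k x) * (v x * partialD j φ x) +
    deriv f (U k x) * partialD j (U k) x * (v x * φ x) + f (U k x) * (z x * φ x)
  have hF0 : ∀ k, ∫ x in Ω, F k x = 0 := fun k => by
    have hfU : ContDiff ℝ ∞ fun x => f (U k x) := hf.comp (hU k)
    have ht := hφ.mul_left hfU
    have e := hv.2.2 _ ht
    have e' : ∀ x, F k x = v x * partialD j (fun x => f (U k x) * φ x) x +
        z x * (f (U k x) * φ x) := fun x => by
      rw [partialD_mul hfU hφ.1, partialD_comp hf (hU k)]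
      simp only [F]
      ring
    have htd := ht.partialD j
    simp only [e']
    rw [integral_add
      (integrable_mul_of_tsupport_subset hv.1 htd.1.continuous htd.2.1 htd.2.2)
      (integrable_mul_of_tsupport_subset hv.2.1 ht.1.continuous ht.2.1 ht.2.2)]
    rw [e, neg_add_cancel]
  have hlim : Tendsto (fun k => ∫ x in Ω, F k x) atTop
      (𝓝 (∫ x in Ω, (f (u x) * (v x * partialD j φ x) +
        deriv f (u x) * w x * (v x * φ x) + f (u x) * (z x * φ x)))) := by
    refine tendsto_integral_of_dominated_convergence (fun x => M * ‖v x * partialD j φ x‖ +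
      M' * C * ‖v x * φ x‖ + M * ‖z x * φ x‖) (fun k => ?_) ?_ (fun k => ?_) ?_
    · have c1 : Continuous fun x => f (U k x) := hf.continuous.comp (hU k).continuous
      have c2 : Continuous fun x => deriv f (U k x) * partialD j (U k) x :=
        (hfc'.comp (hU k).continuous).mul (continuous_partialD (hU k) j)
      exact ((c1.aestronglyMeasurable.mul ivd.1).add (c2.aestronglyMeasurable.mul iv.1)).add
        (c1.aestronglyMeasurable.mul iz.1)
    · exact ((ivd.norm.const_mul M).add (iv.norm.const_mul (M' * C))).add (iz.norm.const_mul M)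
    · refine Eventually.of_forall fun x => ?_
      refine (norm_add₃_le).trans ?_
      simp only [norm_mul _ (v x * _), norm_mul _ (z x * _)]
      refine add_le_add (add_le_add ?_ ?_) ?_
      · exact mul_le_mul_of_nonneg_right (hbM k x) (norm_nonneg _)
      · by_cases hx : x ∈ tsupport φ
        · refine mul_le_mul_of_nonneg_right ?_ (norm_nonneg _)
          rw [norm_mul]
          exact mul_le_mul (hbM' k x) (hUC' k x hx) (norm_nonneg _) hM0'
        · simp [image_eq_zero_of_notMem_tsupport hx]
      · exact mul_le_mul_of_nonneg_right (hbM k x) (norm_nonneg _)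
    · filter_upwards [hUt, hUt'] with x h1 h2
      have t1 := (hf.continuous.tendsto (u x)).comp h1
      have t2 := (hfc'.tendsto (u x)).comp h1
      refine ((t1.mul_const _).add ?_).add (t1.mul_const _)
      by_cases hx : x ∈ tsupport φ
      · exact (t2.mul (h2 hx)).mul_const _
      · simp [image_eq_zero_of_notMem_tsupport hx]
  simp only [hF0] at hlim
  have h0 := tendsto_nhds_unique hlim tendsto_const_nhds
  have s1 := integrable_mul_of_tsupport_subset l1 hφ'.1.continuous hφ'.2.1 hφ'.2.2
  have s2 := integrable_mul_of_tsupport_subset l2 hφ.1.continuous hφ.2.1 hφ.2.2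
  rw [eq_neg_iff_add_eq_zero, ← integral_add s1 s2, ← h0]
  refine integral_congr_ae (Eventually.of_forall fun x => ?_)
  ring

/-- With a smooth factor no approximation is needed: `η φ` is itself a test function. -/
theorem HasWeakPartial.smooth_mul {n : ℕ} {Ω : Set (Eucl n)} {j : Fin n} {η v z : Eucl n → ℝ}
    (hη : ContDiff ℝ ∞ η) (hv : HasWeakPartial Ω j v z) (hΩ : IsOpen Ω) :
    HasWeakPartial Ω j (fun x => η x * v x) (fun x => partialD j η x * v x + η x * z x) := by
  have hc : ∀ {b f : Eucl n → ℝ}, Continuous b → LocallyIntegrableOn f Ω →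
      LocallyIntegrableOn (fun x => b x * f x) Ω := fun hb hf =>
    hf.continuousOn_mul hb.continuousOn hΩ.isLocallyClosed
  have l1 : LocallyIntegrableOn (fun x => η x * v x) Ω := hc hη.continuous hv.1
  have l2 : LocallyIntegrableOn (fun x => partialD j η x * v x + η x * z x) Ω :=
    (hc (continuous_partialD hη j) hv.1).add (hc hη.continuous hv.2.1)
  refine ⟨l1, l2, fun φ hφ => ?_⟩
  have hφ' := hφ.partialD j
  have ht := hφ.mul_left hη
  have htd := ht.partialD j
  have e := hv.2.2 _ ht
  rw [eq_neg_iff_add_eq_zero, ← integral_add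
    (integrable_mul_of_tsupport_subset hv.1 htd.1.continuous htd.2.1 htd.2.2)
    (integrable_mul_of_tsupport_subset hv.2.1 ht.1.continuous ht.2.1 ht.2.2)] at e
  rw [eq_neg_iff_add_eq_zero, ← integral_add
    (integrable_mul_of_tsupport_subset l1 hφ'.1.continuous hφ'.2.1 hφ'.2.2)
    (integrable_mul_of_tsupport_subset l2 hφ.1.continuous hφ.2.1 hφ.2.2), ← e]
  refine integral_congr_ae (Filter.Eventually.of_forall fun x => ?_)
  simp only [partialD_mul hη hφ.1]
  ring

/-- Taking this constant as the second factor turns the product rules into derivative formulas for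
the first factor alone. -/
theorem hasWeakPartial_one {n : ℕ} (Ω : Set (Eucl n)) (j : Fin n) :
    HasWeakPartial Ω j (fun _ => 1) (fun _ => 0) := by
  refine ⟨(locallyIntegrable_const 1).locallyIntegrableOn Ω, locallyIntegrableOn_zero,
    fun φ hφ => ?_⟩
  have hφ' := hφ.partialD j
  rw [setIntegral_eq_integral_of_forall_compl_eq_zero fun x hx => by
    rw [image_eq_zero_of_notMem_tsupport fun h => hx (hφ'.2.2 h), mul_zero]]
  have hi : Integrable (partialD j φ) := hφ'.1.continuous.integrable_of_hasCompactSupport hφ'.2.1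
  have := integral_mul_fderiv_eq_neg_fderiv_mul_of_integrable (μ := volume) (f := fun _ => (1 : ℝ))
    (g := φ) (v := EuclideanSpace.single j 1) (by simp) (by simpa using! hi)
    (by simpa using hφ.1.continuous.integrable_of_hasCompactSupport hφ.2.1)
    (fun x _ => differentiableAt_const _) (fun x _ => (hφ.1.differentiable (by simp)) x)
  simpa [partialD] using this

/-! ### Adjoints and eigenpairs modulo constants -/

namespace FokkerPlanckData

variable {n : ℕ} (S : FokkerPlanckData n)

theorem inner_one_A (ρ : S.A.domain) : ⟪S.one, S.A ρ⟫_ℝ = 0 := by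
  rw [inner_one]
  exact (S.mem_YP _).1 (S.A_mem_YP ρ)

theorem one_ne_zero : S.one ≠ 0 := by
  intro h
  have h1 := S.inner_one S.rhoInf
  rw [h, inner_zero_left, rhoInf, integral_congr_ae S.memLp_rhoInfFun.coeFn_toLp,
    S.integral_rhoInfFun] at h1
  exact zero_ne_one h1

theorem inner_one_rhoInf : ⟪S.one, S.rhoInf⟫_ℝ = 1 := by
  rw [inner_one, rhoInf, integral_congr_ae S.memLp_rhoInfFun.coeFn_toLp, S.integral_rhoInfFun]

theorem Pstar_apply (y : S.Y) : S.Pstar y = y - ⟪S.rhoInf, y⟫_ℝ • S.one := by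
  refine ext_inner_right ℝ fun v => ?_
  rw [Pstar, ContinuousLinearMap.adjoint_inner_left, P_apply, ← inner_one, inner_sub_right,
    inner_sub_left, inner_smul_right, real_inner_smul_left, real_inner_comm y S.rhoInf]
  ring

/-- The orthogonal complement of `𝒴_𝒫` is the line spanned by `𝟙`, which is closed. -/
theorem coe_Θ (y : S.Y) : ∃ c : ℝ, (S.Θ y : S.Y) = y - c • S.one := by
  have h : y - (S.Θ y : S.Y) ∈ (S.YP)ᗮ := S.YP.sub_starProjection_mem_orthogonal y
  rw [Submodule.orthogonal_orthogonal, Submodule.mem_span_singleton] at h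
  obtain ⟨c, hc⟩ := h
  exact ⟨c, by rw [hc]; abel⟩

theorem inner_Θ (y : S.Y) (v : S.YP) : ⟪S.Θ y, v⟫_ℝ = ⟪y, (v : S.Y)⟫_ℝ := by
  obtain ⟨c, hc⟩ := S.coe_Θ y
  have hv : ⟪S.one, (v : S.Y)⟫_ℝ = 0 := Submodule.mem_orthogonal_singleton_iff_inner_right.1 v.2
  rw [Submodule.coe_inner, hc, inner_sub_left, real_inner_smul_left, hv, mul_zero, sub_zero]

/-- Elements of a dense subspace can be corrected by a fixed one to be orthogonal to `𝟙`. -/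
theorem exists_inner_one_eq_one (hd : Dense (S.A.domain : Set S.Y)) :
    ∃ d ∈ S.A.domain, ⟪S.one, d⟫_ℝ = 1 := by
  obtain ⟨d, hd, h⟩ : ∃ d ∈ S.A.domain, ⟪S.one, d⟫_ℝ ≠ 0 := by
    by_contra! h
    exact S.one_ne_zero (hd.eq_zero_of_inner_left ℝ fun v hv => h v hv)
  exact ⟨(⟪S.one, d⟫_ℝ)⁻¹ • d, S.A.domain.smul_mem _ hd, by
    rw [inner_smul_right, inv_mul_cancel₀ h]⟩

/-- A continuous surjection carries dense sets to dense sets. The skew projection along `d` is used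
because `Θ` need not preserve `𝒟(𝒜)`. -/
theorem dense_domain_Ahat (hd : Dense (S.A.domain : Set S.Y)) :
    Dense (S.Ahat.domain : Set S.YP) := by
  obtain ⟨d, hdd, h1⟩ := S.exists_inner_one_eq_one hd
  let T : S.Y → S.YP := fun y => ⟨y - ⟪S.one, y⟫_ℝ • d, by
    rw [Submodule.mem_orthogonal_singleton_iff_inner_right, inner_sub_right, inner_smul_right, h1]
    simp⟩
  have hT : Continuous T := Continuous.subtype_mk (by fun_prop) _
  have hs : Function.Surjective T := fun v => ⟨v, Subtype.ext (by
    simp [T, Submodule.mem_orthogonal_singleton_iff_inner_right.1 v.2])⟩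
  refine (hs.denseRange.dense_image hT hd).mono ?_
  rintro _ ⟨y, hy, rfl⟩
  exact S.A.domain.sub_mem hy (S.A.domain.smul_mem _ hdd)

theorem coe_Ahat_apply (y : S.Ahat.domain) : (S.Ahat y : S.Y) = S.A ⟨(y : S.YP), y.2⟩ := rfl

theorem Asharp_apply (φ : S.Asharp.domain) :
    S.Asharp φ = S.Θ (S.Astar ⟨(φ : S.YP), φ.2⟩) := rfl

theorem inner_Astar (hd : Dense (S.A.domain : Set S.Y)) (φ : S.Astar.domain) (y : S.A.domain) :
    ⟪S.Astar φ, (y : S.Y)⟫_ℝ = ⟪(φ : S.Y), S.A y⟫_ℝ :=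
  LinearPMap.adjoint_isFormalAdjoint hd φ y

theorem adjoint_Ahat (hd : Dense (S.A.domain : Set S.Y)) :
    LinearPMap.adjoint S.Ahat = S.Asharp := by
  have hd' := S.dense_domain_Ahat hd
  obtain ⟨d, hdd, h1⟩ := S.exists_inner_one_eq_one hd
  have hle : S.Asharp ≤ LinearPMap.adjoint S.Ahat := by
    refine LinearPMap.IsFormalAdjoint.le_adjoint hd' fun y φ => ?_
    have e := (S.inner_Θ (S.Astar ⟨(φ : S.YP), φ.2⟩) (y : S.YP)).trans
      (S.inner_Astar hd ⟨(φ : S.YP), φ.2⟩ ⟨(y : S.YP), y.2⟩)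
    rw [real_inner_comm, real_inner_comm _ (y : S.YP)]
    exact e.symm
  refine (LinearPMap.eq_of_le_of_domain_eq hle (le_antisymm hle.1 fun φ hφ => ?_)).symm
  -- Put `ψ = 𝒜̂*φ` and split `y = (y - ⟪𝟙, y⟫d) + ⟪𝟙, y⟫d`. The first part lies in `𝒟(𝒜̂)` and
  -- contributes `⟪ψ, y⟫ - ⟪𝟙, y⟫⟪ψ, d⟫` to `⟪φ, 𝒜y⟫`, the second `⟪𝟙, y⟫⟪φ, 𝒜d⟫`. Collecting the
  -- terms in `⟪𝟙, y⟫` gives the multiple of `𝟙` in the witness.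
  refine LinearPMap.mem_adjoint_domain_of_exists _
    ⟨(LinearPMap.adjoint S.Ahat ⟨φ, hφ⟩ : S.YP) + (⟪(φ : S.Y), S.A ⟨d, hdd⟩⟫_ℝ -
      ⟪((LinearPMap.adjoint S.Ahat ⟨φ, hφ⟩ : S.YP) : S.Y), d⟫_ℝ) • S.one, fun y => ?_⟩
  have hm : (y : S.Y) - ⟪S.one, (y : S.Y)⟫_ℝ • d ∈ S.A.domain :=
    S.A.domain.sub_mem y.2 (S.A.domain.smul_mem _ hdd)
  have hp : (y : S.Y) - ⟪S.one, (y : S.Y)⟫_ℝ • d ∈ S.YP := by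
    rw [Submodule.mem_orthogonal_singleton_iff_inner_right, inner_sub_right, inner_smul_right, h1]
    simp
  have key := LinearPMap.adjoint_isFormalAdjoint hd' ⟨φ, hφ⟩ ⟨⟨_, hp⟩, hm⟩
  rw [Submodule.coe_inner, Submodule.coe_inner, coe_Ahat_apply] at key
  have e : S.A ⟨_, hm⟩ = S.A y - ⟪S.one, (y : S.Y)⟫_ℝ • S.A ⟨d, hdd⟩ := by
    rw [← LinearPMap.map_smul, ← LinearPMap.map_sub]; rfl
  simp only [e, inner_sub_right, inner_smul_right] at key
  rw [inner_add_left, real_inner_smul_left, Submodule.subtype_apply]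
  linarith

/-- Conservation of mass: `ρ ↦ ⟪𝟙, 𝒜ρ⟫` is the zero functional, hence bounded. -/
theorem one_mem_domain_Astar : S.one ∈ S.Astar.domain :=
  LinearPMap.mem_adjoint_domain_of_exists _ ⟨0, fun y => by
    rw [inner_zero_left, inner_one_A]⟩

theorem Astar_one (hd : Dense (S.A.domain : Set S.Y)) :
    S.Astar ⟨S.one, S.one_mem_domain_Astar⟩ = 0 :=
  LinearPMap.adjoint_apply_eq hd _ fun y => by rw [inner_zero_left, inner_one_A]

theorem sub_smul_one_mem_domain_Astar {φ : S.Y} (hφ : φ ∈ S.Astar.domain) (c : ℝ) :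
    φ - c • S.one ∈ S.Astar.domain :=
  S.Astar.domain.sub_mem hφ (S.Astar.domain.smul_mem _ S.one_mem_domain_Astar)

theorem Astar_sub_smul_one (hd : Dense (S.A.domain : Set S.Y)) {φ : S.Y}
    (hφ : φ ∈ S.Astar.domain) (c : ℝ) :
    S.Astar ⟨φ - c • S.one, S.sub_smul_one_mem_domain_Astar hφ c⟩ = S.Astar ⟨φ, hφ⟩ := by
  have h : S.Astar ⟨φ - c • S.one, S.sub_smul_one_mem_domain_Astar hφ c⟩ =
      S.Astar ⟨φ, hφ⟩ - c • S.Astar ⟨S.one, S.one_mem_domain_Astar⟩ := by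
    rw [← LinearPMap.map_smul, ← LinearPMap.map_sub]; rfl
  rw [h, S.Astar_one hd, smul_zero, sub_zero]

theorem isEigenpair_Astar_Pstar (hd : Dense (S.A.domain : Set S.Y))
    (hm : S.rhoInf ∈ S.A.domain) (h0 : S.A ⟨S.rhoInf, hm⟩ = 0) {r : ℝ} {φ : S.YP}
    (h : IsEigenpair S.Asharp r φ) : IsEigenpair S.Astar r (S.Pstar (φ : S.Y)) := by
  obtain ⟨hne, hφ, he⟩ := h
  have hφ' : (φ : S.Y) ∈ S.Astar.domain := hφ
  rw [Pstar_apply]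
  have horth : ⟪S.one, (φ : S.Y)⟫_ℝ = 0 := Submodule.mem_orthogonal_singleton_iff_inner_right.1 φ.2
  refine ⟨fun h => hne (ZeroMemClass.coe_eq_zero.1 ?_), S.sub_smul_one_mem_domain_Astar hφ' _, ?_⟩
  -- If `𝒫*φ = 0`, then `φ` is a multiple of `𝟙` and also orthogonal to it.
  · rw [sub_eq_zero] at h
    rw [← inner_self_eq_zero (𝕜 := ℝ)]
    nth_rewrite 1 [h]
    rw [real_inner_smul_left, horth, mul_zero]
  · rw [S.Astar_sub_smul_one hd hφ']
    obtain ⟨c, hc⟩ := S.coe_Θ (S.Astar ⟨φ, hφ'⟩)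
    have he' : ((S.Θ (S.Astar ⟨φ, hφ'⟩) : S.YP) : S.Y) = r • (φ : S.Y) :=
      congrArg Subtype.val he
    have h1 : S.Astar ⟨φ, hφ'⟩ = r • (φ : S.Y) + c • S.one := by
      rw [← he', hc]; abel
    -- Pairing with the kernel element `ρ_∞`, normalized by `⟪𝟙, ρ_∞⟫ = 1`, determines `c`.
    have h2 := S.inner_Astar hd ⟨φ, hφ'⟩ ⟨S.rhoInf, hm⟩
    rw [h0, inner_zero_right, h1, inner_add_left, real_inner_smul_left, real_inner_smul_left,
      inner_one_rhoInf, real_inner_comm] at h2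
    rw [h1, smul_sub, smul_smul, show c = -(r * ⟪S.rhoInf, (φ : S.Y)⟫_ℝ) by linarith, neg_smul,
      ← sub_eq_add_neg]

theorem Asharp_Θ (hd : Dense (S.A.domain : Set S.Y)) {r : ℝ} {φ : S.Y}
    (h : IsEigenpair S.Astar r φ) :
    ∃ h : S.Θ φ ∈ S.Asharp.domain, S.Asharp ⟨S.Θ φ, h⟩ = r • S.Θ φ := by
  obtain ⟨-, hφ, he⟩ := h
  obtain ⟨c, hc⟩ := S.coe_Θ φ
  have hm : (S.Θ φ : S.Y) ∈ S.Astar.domain := by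
    rw [hc]; exact S.sub_smul_one_mem_domain_Astar hφ c
  refine ⟨hm, ?_⟩
  have h1 : S.Astar ⟨S.Θ φ, hm⟩ = r • φ := by
    rw [← he, ← S.Astar_sub_smul_one hd hφ c]
    congr 1
    exact Subtype.ext hc
  rw [Asharp_apply, h1, map_smul]

/-- The kernel of `Θ` consists of the multiples of `𝟙`. On these `𝒜*` vanishes, so a nonzero one can
only have eigenvalue `0`. -/
theorem Θ_ne_zero (hd : Dense (S.A.domain : Set S.Y)) {r : ℝ} {φ : S.Y}
    (h : IsEigenpair S.Astar r φ) (h' : r ≠ 0 ∨ ¬ ∃ c : ℝ, φ = c • S.one) : S.Θ φ ≠ 0 := by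
  intro h0
  obtain ⟨hne, hφ, he⟩ := h
  obtain ⟨c, hc⟩ := S.coe_Θ φ
  rw [h0, ZeroMemClass.coe_zero] at hc
  have hc' : φ = c • S.one := (sub_eq_zero.1 hc.symm)
  rcases h' with hr | hn
  · have h1 := S.Astar_sub_smul_one hd hφ c
    rw [he] at h1
    have h2 : S.Astar ⟨φ - c • S.one, S.sub_smul_one_mem_domain_Astar hφ c⟩ = 0 := by
      rw [← LinearPMap.map_zero S.Astar]
      congr 1
      exact Subtype.ext hc.symm
    rw [h2] at h1
    exact (smul_ne_zero hr hne) h1.symm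
  · exact hn ⟨c, hc'⟩

end FokkerPlanckData

/-! ### Test functions and compactly supported fields -/

theorem hasWeakPartial_partialD {n : ℕ} {Ω : Set (Eucl n)} (hΩ : IsOpen Ω)
    {η : Eucl n → ℝ} (h : ContDiff ℝ ∞ η) (i : Fin n) :
    HasWeakPartial Ω i η (partialD i η) :=
  ((hasWeakPartial_one Ω i).smooth_mul h hΩ).congr
    (Filter.Eventually.of_forall fun x => by simp)
    (Filter.Eventually.of_forall fun x => by simp)

theorem IsTestFunction.memLp {n : ℕ} {Ω : Set (Eucl n)} {η : Eucl n → ℝ}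
    (h : IsTestFunction Ω η) (p : ℝ≥0∞) : MemLp η p (volume.restrict Ω) :=
  (h.1.continuous.memLp_of_hasCompactSupport h.2.1).restrict Ω

theorem IsTestFunction.memSobolev {n : ℕ} {Ω : Set (Eucl n)} (hΩ : IsOpen Ω) {η : Eucl n → ℝ}
    (h : IsTestFunction Ω η) (k : ℕ) (p : ℝ≥0∞) : MemSobolev Ω k p η := by
  induction k generalizing η with
  | zero => exact h.memLp p
  | succ k ih =>
    exact ⟨h.memLp p, fun i => ⟨_, ih (h.partialD i), hasWeakPartial_partialD hΩ h.1 i⟩⟩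

open Topology Manifold in
/-- A smooth function agrees with a test function near a given compact subset of `Ω`. -/
theorem exists_isTestFunction_eqOn {n : ℕ} {Ω K : Set (Eucl n)} (hΩ : IsOpen Ω)
    (hK : IsCompact K) (hKΩ : K ⊆ Ω) {v : Eucl n → ℝ} (hv : ContDiff ℝ ∞ v) :
    ∃ v', IsTestFunction Ω v' ∧ ∀ x ∈ K, v' =ᶠ[𝓝 x] v := by
  obtain ⟨δ, hδ, hδΩ⟩ := hK.exists_cthickening_subset_open hΩ hKΩ
  have hint : K ⊆ interior (Metric.cthickening δ K) :=
    (Metric.self_subset_thickening hδ K).trans (Metric.thickening_subset_interior_cthickening δ K)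
  obtain ⟨χ, h1, h0, -⟩ := exists_contMDiffMap_one_nhds_of_subset_interior (n := (⊤ : ℕ∞))
    𝓘(ℝ, Eucl n) hK.isClosed hint
  have hχ : tsupport χ ⊆ Metric.cthickening δ K :=
    closure_minimal (fun x hx => by_contra fun h => hx (h0 x h)) Metric.isClosed_cthickening
  have ht : IsTestFunction Ω χ := ⟨χ.contMDiff.contDiff,
    hK.cthickening.of_isClosed_subset (isClosed_tsupport _) hχ, hχ.trans hδΩ⟩
  refine ⟨_, ht.mul_left hv, fun x hx => ?_⟩
  filter_upwards [Filter.Eventually.filter_mono (nhds_le_nhdsSet hx) h1] with y hy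
  rw [hy, mul_one]

/-- A field with a weak divergence that is supported in a compact subset of `Ω` has zero normal
trace. -/
theorem HasWeakDiv.hasZeroNormalTrace {n : ℕ} {Ω K : Set (Eucl n)} (hΩ : IsOpen Ω)
    (hK : IsCompact K) (hKΩ : K ⊆ Ω) {F : Fin n → Eucl n → ℝ} {w : Eucl n → ℝ}
    (h : HasWeakDiv Ω F w) (hF : ∀ i, MemLp (F i) 2 (volume.restrict Ω))
    (hw : MemLp w 2 (volume.restrict Ω)) (hF0 : ∀ i, ∀ x ∉ K, F i x = 0)
    (hw0 : ∀ x ∉ K, w x = 0) : HasZeroNormalTrace Ω F := by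
  refine ⟨hF, w, hw, h, fun v hv => ?_⟩
  -- `v` need not vanish near the boundary, so it is replaced by a test function equal to it near
  -- `K`. Equality on a neighbourhood also preserves the derivatives on `K`, and off `K` both `F`
  -- and `w` vanish.
  obtain ⟨v', hv', he⟩ := exists_isTestFunction_eqOn hΩ hK hKΩ hv
  have e1 : ∀ x, ∑ i, F i x * partialD i v x = ∑ i, F i x * partialD i v' x := fun x => by
    refine Finset.sum_congr rfl fun i _ => ?_
    by_cases hx : x ∈ K
    · rw [partialD, partialD, (he x hx).fderiv_eq]
    · rw [hF0 i x hx, zero_mul, zero_mul]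
  have e2 : ∀ x, w x * v x = w x * v' x := fun x => by
    by_cases hx : x ∈ K
    · rw [(he x hx).eq_of_nhds]
    · rw [hw0 x hx, zero_mul, zero_mul]
  simp only [e1, e2]
  rw [h.2.2 v' hv', neg_add_cancel]

/-! ### Density of the domain of `𝒜` -/

namespace FokkerPlanckData

variable {n : ℕ} (S : FokkerPlanckData n)

theorem memLp_weakPartial_G (i : Fin n) : MemLp (weakPartial S.Ω i S.G) ⊤ S.μ :=
  S.G_mem₁.weakPartial S.isOpen i

theorem hasWeakPartial_weakPartial_G (i j : Fin n) :
    HasWeakPartial S.Ω j (weakPartial S.Ω i S.G)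
      (weakPartial S.Ω j (weakPartial S.Ω i S.G)) :=
  (S.G_mem₂.weakPartial S.isOpen i).hasWeakPartial j

theorem memLp_weakPartial_weakPartial_G (i j : Fin n) :
    MemLp (weakPartial S.Ω j (weakPartial S.Ω i S.G)) 2 S.μ :=
  MemLp.mono_exponent
    ((S.G_mem₂.weakPartial S.isOpen i).weakPartial S.isOpen j).memLp (le_max_left _ _)

theorem toLp_mem_domain_A {ρ : Eucl n → ℝ} (hρ : MemSobolev S.Ω 2 2 ρ)
    (ht : HasZeroNormalTrace S.Ω (S.flux ρ)) : hρ.memLp.toLp ρ ∈ S.A.domain := by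
  have e := hρ.memLp.coeFn_toLp.symm
  refine ⟨hρ.congr e, ht.congr fun i => ?_⟩
  -- Scaling by `1` serves as invariance of the flux under a.e. equality.
  simpa using S.flux_const_mul 1 hρ (by simpa using e) i

theorem flux_eq {ρ : Eucl n → ℝ} {i : Fin n} {d : Eucl n → ℝ} (h : HasWeakPartial S.Ω i ρ d) :
    S.flux ρ i =ᵐ[S.μ] fun x => S.ν * d x + ρ x * weakPartial S.Ω i S.G x := by
  filter_upwards [(hasWeakPartial_weakPartial ⟨_, h⟩).ae_unique S.isOpen h] with x hx
  rw [flux, drift, hx]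

/-- The flux is supported in `tsupport η`. Its divergence `νΔη + ∇η · ∇G + ηΔG` is square integrable
because `∇G` and the second derivatives of `G` are. -/
theorem hasZeroNormalTrace_flux_of_isTestFunction {η : Eucl n → ℝ} (h : IsTestFunction S.Ω η) :
    HasZeroNormalTrace S.Ω (S.flux η) := by
  have hp : ∀ i, HasWeakPartial S.Ω i
      (fun x => S.ν * partialD i η x + η x * weakPartial S.Ω i S.G x) _ := fun i =>
    ((hasWeakPartial_partialD S.isOpen (h.partialD i).1 i).const_mul S.ν).add
      ((S.hasWeakPartial_weakPartial_G i i).smooth_mul h.1 S.isOpen)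
  have hz : ∀ i, ∀ x ∉ tsupport η, partialD i η x = 0 := fun i x hx =>
    image_eq_zero_of_notMem_tsupport fun hx' => hx (tsupport_partialD_subset η i hx')
  have hz' : ∀ i, ∀ x ∉ tsupport η, partialD i (partialD i η) x = 0 := fun i x hx =>
    image_eq_zero_of_notMem_tsupport fun hx' =>
      hx (tsupport_partialD_subset η i (tsupport_partialD_subset _ i hx'))
  have hG : ∀ i, MemLp (weakPartial S.Ω i S.G) 2 S.μ := fun i =>
    (S.memLp_weakPartial_G i).mono_exponent le_top
  refine HasZeroNormalTrace.congr ?_ fun i =>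
    (S.flux_eq (hasWeakPartial_partialD S.isOpen h.1 i)).symm
  refine (HasWeakPartial.hasWeakDiv hp).hasZeroNormalTrace S.isOpen h.2.1 h.2.2
    (fun i => (((h.partialD i).memLp 2).const_mul _).add ((hG i).mul' (h.memLp ⊤)))
    (memLp_finsetSum _ fun i _ => ((((h.partialD i).partialD i).memLp 2).const_mul _).add
      (((hG i).mul' ((h.partialD i).memLp ⊤)).add
        ((S.memLp_weakPartial_weakPartial_G i i).mul' (h.memLp ⊤))))
    (fun i x hx => ?_) (fun x hx => ?_)
  · rw [hz i x hx, image_eq_zero_of_notMem_tsupport hx]; simp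
  · refine Finset.sum_eq_zero fun i _ => ?_
    rw [hz i x hx, hz' i x hx, image_eq_zero_of_notMem_tsupport hx]; simp

/-- Test functions lie in the domain, so a function orthogonal to it vanishes by the fundamental
lemma of the calculus of variations. -/
theorem dense_domain_A : Dense (S.A.domain : Set S.Y) := by
  rw [Submodule.dense_iff_topologicalClosure_eq_top, Submodule.topologicalClosure_eq_top_iff,
    Submodule.eq_bot_iff]
  intro f hf
  have hfi : Integrable f S.μ := (Lp.memLp f).integrable (by norm_num)
  have key := S.isOpen.ae_eq_zero_of_integral_contDiff_smul_eq_zero (μ := volume) (f := f)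
    (IntegrableOn.locallyIntegrableOn hfi) (by
      intro g hg hgc hgs
      have hφ : IsTestFunction S.Ω g := ⟨hg, hgc, hgs⟩
      have hs := hφ.memSobolev S.isOpen 2 2
      have h0 := (Submodule.mem_orthogonal _ _).1 hf _
        (S.toLp_mem_domain_A hs (S.hasZeroNormalTrace_flux_of_isTestFunction hφ))
      rw [L2.inner_def] at h0
      rw [← setIntegral_eq_integral_of_forall_compl_eq_zero (s := S.Ω), ← h0]
      · refine integral_congr_ae ?_
        filter_upwards [hs.memLp.coeFn_toLp] with x hx
        rw [hx]
        simp [mul_comm]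
      · intro x hx
        rw [image_eq_zero_of_notMem_tsupport fun h => hx (hgs h), zero_smul])
  rw [Lp.eq_zero_iff_ae_eq_zero]
  refine (ae_restrict_iff' S.isOpen.measurableSet).2 ?_
  filter_upwards [key] with x hx hxΩ using hx hxΩ

/-! ### The stationary state lies in the kernel of `𝒜` -/

/-- Here `e^{-Φ} = f(G)` with `f' = -f/ν`. The extra factor `v` lets one rule yield both first
derivatives (`v = 1`) and second derivatives (`v = ∂ᵢG`). -/
theorem hasWeakPartial_exp_mul {i : Fin n} {v z : Eucl n → ℝ} (hv : HasWeakPartial S.Ω i v z) :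
    HasWeakPartial S.Ω i (fun x => Real.exp (-S.Φ x) * v x) (fun x =>
      -S.ν⁻¹ * (Real.exp (-S.Φ x) * (weakPartial S.Ω i S.G x * v x)) +
        Real.exp (-S.Φ x) * z x) := by
  have hf : ContDiff ℝ ∞ fun t : ℝ => Real.exp (-(Real.log S.ν + t / S.ν)) := by fun_prop
  have hd : ∀ t : ℝ, deriv (fun t : ℝ => Real.exp (-(Real.log S.ν + t / S.ν))) t =
      Real.exp (-(Real.log S.ν + t / S.ν)) * -S.ν⁻¹ := fun t => by
    simp
  refine (HasWeakPartial.comp_mul S.isOpen S.G_mem₁.memLp (S.memLp_weakPartial_G i)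
    (S.G_mem₁.hasWeakPartial i) hv hf).congr (by rfl) (Filter.Eventually.of_forall fun x => ?_)
  simp only [hd, Φ]
  ring

theorem hasWeakPartial_exp (i : Fin n) :
    HasWeakPartial S.Ω i (fun x => Real.exp (-S.Φ x)) (fun x =>
      -S.ν⁻¹ * (Real.exp (-S.Φ x) * weakPartial S.Ω i S.G x)) :=
  (S.hasWeakPartial_exp_mul (hasWeakPartial_one S.Ω i)).congr
    (Filter.Eventually.of_forall fun x => by simp)
    (Filter.Eventually.of_forall fun x => by simp)

/-- Second derivatives consist of a term `e^{-Φ} ∂ⱼG ∂ᵢG`, controlled by `G ∈ W^{1,∞}`, and a term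
`e^{-Φ} ∂ⱼ∂ᵢG`, a bounded function times an `L²` function. -/
theorem memSobolev_exp : MemSobolev S.Ω 2 2 fun x => Real.exp (-S.Φ x) := by
  have hG : ∀ i, MemLp (weakPartial S.Ω i S.G) 2 S.μ := fun i =>
    (S.memLp_weakPartial_G i).mono_exponent le_top
  have hE := S.memLp_exp ⊤
  refine ⟨S.memLp_exp 2, fun i => ⟨_, ⟨?_, fun j => ⟨_, ?_,
    (S.hasWeakPartial_exp_mul (S.hasWeakPartial_weakPartial_G i j)).const_mul _⟩⟩,
    S.hasWeakPartial_exp i⟩⟩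
  · exact ((hG i).mul' hE : MemLp _ 2 S.μ).const_mul _
  · have h1 : MemLp (fun x => weakPartial S.Ω j S.G x * weakPartial S.Ω i S.G x) 2 S.μ :=
      (hG i).mul' (S.memLp_weakPartial_G j)
    have h2 : MemLp (fun x => Real.exp (-S.Φ x) *
        (weakPartial S.Ω j S.G x * weakPartial S.Ω i S.G x)) 2 S.μ := h1.mul' hE
    have h3 : MemLp (fun x => Real.exp (-S.Φ x) *
        weakPartial S.Ω j (weakPartial S.Ω i S.G) x) 2 S.μ :=
      (S.memLp_weakPartial_weakPartial_G i j).mul' hE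
    exact ((h2.const_mul _).add h3).const_mul _

/-- Diffusion and drift cancel pointwise: `ν∇e^{-Φ} = -e^{-Φ}∇G`. -/
theorem flux_exp (i : Fin n) :
    S.flux (fun x => Real.exp (-S.Φ x)) i =ᵐ[S.μ] fun _ => 0 := by
  refine (S.flux_eq (S.hasWeakPartial_exp i)).trans (Filter.Eventually.of_forall fun x => ?_)
  have := S.ν_pos.ne'
  simp only
  field_simp
  ring

theorem hasWeakDiv_zero (Ω : Set (Eucl n)) : HasWeakDiv Ω (fun _ _ => 0) (fun _ => 0) :=
  ⟨fun _ => locallyIntegrableOn_zero, locallyIntegrableOn_zero, by simp⟩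

theorem hasZeroNormalTrace_flux_exp :
    HasZeroNormalTrace S.Ω (S.flux fun x => Real.exp (-S.Φ x)) := by
  have ht : HasZeroNormalTrace S.Ω (fun _ _ => 0) :=
    ⟨fun _ => MemLp.zero', _, MemLp.zero', hasWeakDiv_zero S.Ω, by simp⟩
  exact ht.congr fun i => (S.flux_exp i).symm

theorem rhoInf_eq : S.rhoInf = (∫ y in S.Ω, Real.exp (-S.Φ y))⁻¹ •
    S.memSobolev_exp.memLp.toLp (fun x => Real.exp (-S.Φ x)) := by
  rw [rhoInf, ← MemLp.toLp_const_smul]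
  congr 1
  funext x
  simp [rhoInfFun, div_eq_inv_mul]

theorem exp_mem_domain_A :
    S.memSobolev_exp.memLp.toLp (fun x => Real.exp (-S.Φ x)) ∈ S.A.domain :=
  S.toLp_mem_domain_A S.memSobolev_exp S.hasZeroNormalTrace_flux_exp

/-- The flux is a.e. zero, so `0` and `𝒜e^{-Φ}` are both its weak divergence, which is unique. -/
theorem A_exp : S.A ⟨_, S.exp_mem_domain_A⟩ = 0 := by
  rw [Lp.eq_zero_iff_ae_eq_zero]
  refine (S.coeFn_opALp ⟨_, S.exp_mem_domain_A⟩).trans ?_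
  refine (S.hasWeakDiv_flux S.exp_mem_domain_A.1 S.exp_mem_domain_A.2).ae_unique S.isOpen
    ((hasWeakDiv_zero S.Ω).congr (fun i => ?_) (by rfl))
  have e := S.memSobolev_exp.memLp.coeFn_toLp.symm
  refine (S.flux_exp i).symm.trans ?_
  simpa using S.flux_const_mul 1 S.memSobolev_exp (by simpa using e) i

theorem rhoInf_mem_domain_A : S.rhoInf ∈ S.A.domain := by
  rw [rhoInf_eq]
  exact S.A.domain.smul_mem _ S.exp_mem_domain_A

theorem A_rhoInf : S.A ⟨S.rhoInf, S.rhoInf_mem_domain_A⟩ = 0 := by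
  have h : (⟨S.rhoInf, S.rhoInf_mem_domain_A⟩ : S.A.domain) =
      (∫ y in S.Ω, Real.exp (-S.Φ y))⁻¹ • ⟨_, S.exp_mem_domain_A⟩ := Subtype.ext S.rhoInf_eq
  rw [h, LinearPMap.map_smul, A_exp, smul_zero]

end FokkerPlanckData

/-- Besides the three claims, the density of `𝒟(𝒜)` and `𝒟(𝒜̂)`, without which the adjoints are
not defined, is part of the conclusion. -/
theorem mainTheorem10 (n : ℕ) (S : FokkerPlanckData n) :
    (Dense (S.A.domain : Set S.Y) ∧ Dense (S.Ahat.domain : Set S.YP) ∧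
      LinearPMap.adjoint S.Ahat = S.Asharp) ∧
    (∀ (r : ℝ) (φ : S.YP),
      IsEigenpair S.Asharp r φ → IsEigenpair S.Astar r (S.Pstar (φ : S.Y))) ∧
    (∀ (r : ℝ) (φ : S.Y), IsEigenpair S.Astar r φ →
      (∃ h : S.Θ φ ∈ S.Asharp.domain, S.Asharp ⟨S.Θ φ, h⟩ = r • S.Θ φ) ∧
      ((r ≠ 0 ∨ ¬ ∃ c : ℝ, φ = c • S.one) → IsEigenpair S.Asharp r (S.Θ φ))) := by
  have hd := S.dense_domain_A
  exact ⟨⟨hd, S.dense_domain_Ahat hd, S.adjoint_Ahat hd⟩,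
    fun r φ h => S.isEigenpair_Astar_Pstar hd S.rhoInf_mem_domain_A S.A_rhoInf h,
    fun r φ h => ⟨S.Asharp_Θ hd h, fun h' => ⟨S.Θ_ne_zero hd h h', S.Asharp_Θ hd h⟩⟩⟩
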